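/- Let $B$ be a standard real Brownian motion, $\sigma\in(0,\infty)$, and let $\mu:(0,\infty)\to(0,\infty)$ be strictly decreasing and continuous with $\lim_{a\to0^+}\mu(a)=\infty$; put $\mu(\infty):=\lim_{a\to\infty}\mu(a)\ge 0$. For $t\ge 0$ let $X_t(0):=0$ and $X_t(a):=\sigma B_t-\mu(a)t$ for $a\in(0,\infty]$, and let $M_*(a):=\sup_{t\ge0}X_t(a)$ for $a\in[0,\infty]$. Let $w$ be a finite initial condition, that is, a stochastic process $w:\mathbb{R}_+\to\mathbb{R}_+$, independent of $B$, with continuous nondecreasing paths, $w(0)=0$, $\mathbb{E}\big[\int_0^1 w(a)a^{-2}\,da\big]<\infty$ and $\mathbb{E}[w(\infty)]<\infty$, where $w(\infty):=\lim_{a\to\infty}w(a)$. For $t\ge0$ and $a\in[0,\infty]$ let $\chi_t(a):=w(a)+X_t(a)$ and $$W_t^w(a):=\chi_t(a)-\Big(\inf_{0\le s\le t}\chi_s(a)\Big)\wedge 0 .$$ Let $\mathbf{C}(\mathbb{R}_+)$ be the space of continuous real functions on $\mathbb{R}_+$ with the topology of uniform convergence on compact sets, and $\mathbb{M}$ the space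 of finite nonnegative Borel measures on $\mathbb{R}_+$ with the topology of weak convergence. (i) Almost surely, $W_t^w(\cdot)$ is nonnegative and continuous on $\mathbb{R}_+$ for every $t\ge0$, and $M_*(\cdot)$ is nonnegative, finite and continuous on $\mathbb{R}_+$. As $t\to\infty$, $W_t^w(\cdot)\to M_*(\cdot)$ in distribution in $\mathbf{C}(\mathbb{R}_+)$. If $\mu(\infty)>0$, then $M_*(\infty)<\infty$ almost surely and $(W_t^w(\cdot),W_t^w(\infty))\to(M_*(\cdot),M_*(\infty))$ in distribution in $\mathbf{C}(\mathbb{R}_+)\times\mathbb{R}_+$ as $t\to\infty$. (ii) Suppose in addition that $\int_0^\infty\frac{da}{a^2\mu(a)}<\infty$. Then, for each $t\ge0$, almost surely there is a unique $\mathcal{Z}_t^w\in\mathbb{M}$ with $$\mathcal{Z}_t^w(\{0\})=0,\qquad \mathcal{Z}_t^w([0,a])=\int_0^a\frac{W_t^w(x)}{x^2}\,dx+\frac{W_t^w(a)}{a}\quad(0<a<\infty),\qquad \mathcal{Z}_t^w([0,\infty))=\int_0^\infty\frac{W_t^w(x)}{x^2}\,dx,$$ and almost surely there is a unique $\mathcal{M}_*\in\mathbb{M}$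 that satisfies the same three relations with $M_*$ in place of $W_t^w$. As $t\to\infty$, $(W_t^w(\cdot),\mathcal{Z}_t^w)\to(M_*(\cdot),\mathcal{M}_*)$ in distribution in $\mathbf{C}(\mathbb{R}_+)\times\mathbb{M}$. If moreover $\mu(\infty)>0$, then $(W_t^w(\cdot),W_t^w(\infty),\mathcal{Z}_t^w)\to(M_*(\cdot),M_*(\infty),\mathcal{M}_*)$ in distribution in $\mathbf{C}(\mathbb{R}_+)\times\mathbb{R}_+\times\mathbb{M}$ as $t\to\infty$. -/

import Mathlib

open MeasureTheory ProbabilityTheory Filter Topology Set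
open scoped NNReal ENNReal

noncomputable section

namespace RCBM

/-- A drift function: strictly decreasing and continuous from `(0, ∞)` to `(0, ∞)`, with
limit `∞` at `0+`. Only the values of `μ` on `(0, ∞)` matter. -/
structure IsDriftFunction (μ : ℝ → ℝ) : Prop where
  pos : ∀ a, 0 < a → 0 < μ a
  strictAnti : StrictAntiOn μ (Ioi 0)
  continuousOn : ContinuousOn μ (Ioi 0)
  tendsto_zero : Tendsto μ (𝓝[>] 0) atTop

/-- `μ(∞) = lim_{a → ∞} μ(a)`; the limit exists for every drift function. -/
def driftAtInfty (μ : ℝ → ℝ) : ℝ := limUnder atTop μ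

/-- The drift function extended to `(0, ∞]`. -/
def driftExt (μ : ℝ → ℝ) (a : ℝ≥0∞) : ℝ :=
  if a = ∞ then driftAtInfty μ else μ a.toReal

variable {Ω : Type*}

/-- Coupled Brownian motions started from zero: `X_t(0) = 0` and
`X_t(a) = σ B_t - μ(a) t` for `a ∈ (0, ∞]`. -/
def X (σ : ℝ) (μ : ℝ → ℝ) (B : ℝ≥0 → Ω → ℝ) (t : ℝ≥0) (a : ℝ≥0∞) (ω : Ω) : ℝ :=
  if a = 0 then 0 else σ * B t ω - driftExt μ a * t

/-- The maximum process `M_*(a) = sup_{t ≥ 0} X_t(a)`. -/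
def Mstar (σ : ℝ) (μ : ℝ → ℝ) (B : ℝ≥0 → Ω → ℝ) (a : ℝ≥0∞) (ω : Ω) : ℝ :=
  ⨆ t : ℝ≥0, X σ μ B t a ω

/-- The one-dimensional Skorokhod map `Ψ[f](t) = f(t) - (inf_{0 ≤ s ≤ t} f(s)) ∧ 0`. -/
def skorokhodMap (f : ℝ≥0 → ℝ) (t : ℝ≥0) : ℝ :=
  f t - min (sInf (f '' Icc 0 t)) 0

/-- `w(∞) = lim_{a → ∞} w(a)`, in `[0, ∞]`. -/
def initAtInfty (w : ℝ≥0 → Ω → ℝ≥0) (ω : Ω) : ℝ≥0∞ :=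
  limUnder atTop (fun a : ℝ≥0 => (w a ω : ℝ≥0∞))

/-- The initial condition extended to `[0, ∞]`. -/
def initExt (w : ℝ≥0 → Ω → ℝ≥0) (a : ℝ≥0∞) (ω : Ω) : ℝ :=
  if a = ∞ then (initAtInfty w ω).toReal else (w a.toNNReal ω : ℝ)

/-- The finite initial conditions: continuous nondecreasing processes `w`, independent of `B`,
with `w(0) = 0`, `E ∫₀¹ w(a) / a² da < ∞` and `E w(∞) < ∞`. -/
structure IsFiniteInitialCondition [MeasurableSpace Ω] (P : Measure Ω) (B : ℝ≥0 → Ω → ℝ)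
    (w : ℝ≥0 → Ω → ℝ≥0) : Prop where
  aemeasurable : ∀ a, AEMeasurable (w a) P
  indep : IndepFun (fun ω a => w a ω) (fun ω t => B t ω) P
  continuous : ∀ᵐ ω ∂P, Continuous fun a => w a ω
  monotone : ∀ᵐ ω ∂P, Monotone fun a => w a ω
  zero : ∀ᵐ ω ∂P, w 0 ω = 0
  lintegral_lt_top :
    (∫⁻ ω, (∫⁻ a in Ioc (0 : ℝ) 1, ENNReal.ofReal (w a.toNNReal ω / a ^ 2)) ∂P) < ∞
  lintegral_infty_lt_top : (∫⁻ ω, initAtInfty w ω ∂P) < ∞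

/-- `χ_t(a) = w(a) + X_t(a)`. -/
def chi (σ : ℝ) (μ : ℝ → ℝ) (B : ℝ≥0 → Ω → ℝ) (w : ℝ≥0 → Ω → ℝ≥0)
    (t : ℝ≥0) (a : ℝ≥0∞) (ω : Ω) : ℝ :=
  initExt w a ω + X σ μ B t a ω

/-- Reflecting coupled Brownian motions `W_t(a) = Ψ[χ_·(a)](t)`, for `a ∈ [0, ∞]`. -/
def W (σ : ℝ) (μ : ℝ → ℝ) (B : ℝ≥0 → Ω → ℝ) (w : ℝ≥0 → Ω → ℝ≥0)
    (t : ℝ≥0) (a : ℝ≥0∞) (ω : Ω) : ℝ :=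
  skorokhodMap (fun s => chi σ μ B w s a ω) t

/-- The restriction to `[0, ∞)` of a function on `[0, ∞]`, as an element of the space `C(ℝ₊)`
(with the topology of uniform convergence on compact sets). The default value `0` is used only
where the restriction is not continuous. -/
def toPath (f : ℝ≥0∞ → ℝ) : C(ℝ≥0, ℝ) :=
  open scoped Classical in
  if h : Continuous (fun a : ℝ≥0 => f a) then ⟨fun a : ℝ≥0 => f a, h⟩ else 0

/-- `ζ` is the measure associated with `f`: `ζ{0} = 0`,
`ζ[0, a] = ∫₀ᵃ f(x) / x² dx + f(a) / a` for `a ∈ (0, ∞)`, and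
`ζ[0, ∞) = ∫₀^∞ f(x) / x² dx`. -/
structure IsAssociatedMeasure (f : ℝ≥0∞ → ℝ) (ζ : FiniteMeasure ℝ≥0) : Prop where
  zero : (ζ : Measure ℝ≥0) {0} = 0
  Icc : ∀ a : ℝ≥0, 0 < a → (ζ : Measure ℝ≥0) (Set.Icc 0 a) =
    (∫⁻ x in Ioc (0 : ℝ) a, ENNReal.ofReal (f (ENNReal.ofReal x) / x ^ 2))
      + ENNReal.ofReal (f a / a)
  univ : (ζ : Measure ℝ≥0) Set.univ =
    ∫⁻ x in Ioi (0 : ℝ), ENNReal.ofReal (f (ENNReal.ofReal x) / x ^ 2)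

/-- The finite measure associated with `f`; the default value `0` is used only where there is
none. -/
def associatedMeasure (f : ℝ≥0∞ → ℝ) : FiniteMeasure ℝ≥0 :=
  open scoped Classical in
  if h : ∃ ζ, IsAssociatedMeasure f ζ then h.choose else 0

/-- Convergence in distribution, as `t → ∞`, of random elements of a topological space `S`
equipped with its Borel σ-algebra. -/
def ConvergesInDistribution [MeasurableSpace Ω] (P : Measure Ω) [IsProbabilityMeasure P]
    {S : Type*} [TopologicalSpace S] (Y : ℝ≥0 → Ω → S) (Y' : Ω → S) : Prop :=
  letI : MeasurableSpace S := borel S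
  haveI : BorelSpace S := ⟨rfl⟩
  TendstoInDistribution Y atTop Y' (fun _ => P) P

end RCBM

end

/-! Seen backwards from time t, reflection becomes a maximum: W_t(a) is the larger of sup_{s ≤ t}
(X_t(a) - X_s(a)) and w(a) + X_t(a) (`W_eq_Wrev_revProc`). One time reversal of B on [0, t] serves
all a simultaneously, and the reversed path is again a Brownian motion independent of w. Hence, for
each fixed t, the whole family W_t(·) has the law of `Wrev`, the maximum of the running maximum
sup_{s ≤ t} X_s(a) and of w(a) + X_t(a) (`identDistrib_W_Wrev`).

Unlike W, the process `Wrev` converges almost surely. If the drift at c is positive, every X_t(a)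
with 0 < a ≤ c lies below X_t(c), which tends to -∞. After a random time the running maxima have
therefore reached M_*, the initial condition no longer counts, and `Wrev` equals M_* on all of [0,
c] (`eventually_Wrev_eq`); c = ∞ is allowed when μ(∞) > 0. Almost sure convergence of variables with
the right law at each t is enough for convergence in distribution.

For the measures, let f be continuous and nondecreasing with f(0) = 0 and f(x)/x² integrable. Then
∫₀ᵃ f(x)/x² dx + f(a)/a is a continuous distribution function with limit ∫₀^∞ f(x)/x² dx, so the
measure exists. Eventual equality of the functions on bounded intervals gives eventual equality of
the measures there, and weak convergence only needs convergence of the masses. This is dominated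
convergence with bound (M_*(x) + w(x))/x². Doob's inequality for an exponential martingale gives E
M_*(a) ≤ σ²/(2μ(a)), so Tonelli and the hypothesis on μ make M_*(x)/x² integrable
(`ae_lintegral_Mstar_lt_top`).

Measurability rests on two countable reductions: a path is determined measurably by its values on a
dense sequence (`measurableEmbedding_evalDense`), and the weak topology is induced by countably many
integrals (`isInducing_testIntegrals`). -/

namespace RCBM

/-! ### The weak topology on finite measures on the half-line -/

/-- The continuous cutoff function equal to `1` on `[0, n]` and to `0` on `[n + 1, ∞)`. -/
noncomputable def cutoff (n : ℕ) (x : ℝ≥0) : ℝ := max 0 (min 1 (n + 1 - (x : ℝ)))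

lemma continuous_cutoff (n : ℕ) : Continuous (cutoff n) := by unfold cutoff; fun_prop

lemma cutoff_nonneg (n : ℕ) (x : ℝ≥0) : 0 ≤ cutoff n x := le_max_left _ _

lemma cutoff_le_one (n : ℕ) (x : ℝ≥0) : cutoff n x ≤ 1 :=
  max_le zero_le_one (min_le_left _ _)

lemma cutoff_eq_zero {n : ℕ} {x : ℝ≥0} (hx : (n : ℝ) + 1 ≤ x) : cutoff n x = 0 := by
  unfold cutoff
  exact max_eq_left (min_le_of_right_le (by linarith))

lemma cutoff_eq_one {n : ℕ} {x : ℝ≥0} (hx : (x : ℝ) ≤ n) : cutoff n x = 1 := by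
  unfold cutoff
  rw [min_eq_left (by linarith), max_eq_right zero_le_one]

lemma integrable_cutoff (n : ℕ) (ζ : Measure ℝ≥0) [IsFiniteMeasure ζ] :
    Integrable (cutoff n) ζ :=
  Integrable.of_bound (continuous_cutoff n).aestronglyMeasurable 1 (.of_forall fun x => by
    rw [Real.norm_of_nonneg (cutoff_nonneg n x)]; exact cutoff_le_one n x)

/-- The product of a cutoff function and a continuous function, as a bounded continuous
function. -/
noncomputable def cutoffMul (n : ℕ) (g : C(ℝ≥0, ℝ)) : BoundedContinuousFunction ℝ≥0 ℝ :=
  BoundedContinuousFunction.ofNormedAddCommGroup (fun x => cutoff n x * g x)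
    ((continuous_cutoff n).mul g.continuous)
    (max (isCompact_Icc.exists_bound_of_continuousOn (s := Icc (0 : ℝ≥0) (n + 1))
      (f := fun x => g x) g.continuous.continuousOn).choose 0) fun x => by
    have h := (isCompact_Icc.exists_bound_of_continuousOn (s := Icc (0 : ℝ≥0) (n + 1))
      (f := fun x => g x) g.continuous.continuousOn).choose_spec
    by_cases hx : x ≤ n + 1
    · refine le_trans ?_ (le_max_left _ _)
      refine le_trans ?_ (h x ⟨zero_le, hx⟩)
      rw [norm_mul, Real.norm_of_nonneg (cutoff_nonneg n x)]
      exact mul_le_of_le_one_left (norm_nonneg _) (cutoff_le_one n x)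
    · rw [cutoff_eq_zero (by exact_mod_cast (not_le.mp hx).le)]
      simp

@[simp] lemma cutoffMul_apply (n : ℕ) (g : C(ℝ≥0, ℝ)) (x : ℝ≥0) :
    cutoffMul n g x = cutoff n x * g x := rfl

/-- The integrals of a finite measure against countably many test functions. -/
noncomputable def testIntegrals (ζ : FiniteMeasure ℝ≥0) : (ℕ → ℝ) × (ℕ × ℕ → ℝ) × ℝ :=
  (fun n => ∫ x, cutoffMul n 1 x ∂(ζ : Measure ℝ≥0),
    fun p => ∫ x, cutoffMul p.1 (TopologicalSpace.denseSeq C(ℝ≥0, ℝ) p.2) x ∂(ζ : Measure ℝ≥0),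
    (ζ : Measure ℝ≥0).real univ)

lemma continuous_testIntegrals : Continuous testIntegrals := by
  refine (continuous_pi fun n => ?_).prodMk ((continuous_pi fun p => ?_).prodMk ?_)
  · exact FiniteMeasure.continuous_integral_boundedContinuousFunction _
  · exact FiniteMeasure.continuous_integral_boundedContinuousFunction _
  · exact NNReal.continuous_coe.comp FiniteMeasure.continuous_mass

lemma tendsto_integral_cutoff (ζ : Measure ℝ≥0) [IsFiniteMeasure ζ] :
    Tendsto (fun n => ∫ x, cutoff n x ∂ζ) atTop (𝓝 (ζ.real univ)) := by
  have h1 : ζ.real univ = ∫ _, (1 : ℝ) ∂ζ := by simp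
  rw [h1]
  refine tendsto_integral_of_dominated_convergence (fun _ => 1)
    (fun n => (continuous_cutoff n).aestronglyMeasurable) (by simp) (fun n => ?_) ?_
  · exact .of_forall fun x => by
      rw [Real.norm_of_nonneg (cutoff_nonneg n x)]; exact cutoff_le_one n x
  · refine .of_forall fun x => tendsto_const_nhds.congr' ?_
    filter_upwards [eventually_ge_atTop ⌈(x : ℝ)⌉₊] with n hn
    exact (cutoff_eq_one ((Nat.le_ceil _).trans (by exact_mod_cast hn))).symm

lemma exists_denseSeq_dist_le (f : C(ℝ≥0, ℝ)) (n : ℕ) {δ : ℝ} (hδ : 0 < δ) :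
    ∃ k, ∀ x : ℝ≥0, (x : ℝ) ≤ n + 1 → |f x - TopologicalSpace.denseSeq C(ℝ≥0, ℝ) k x| < δ := by
  have hU : {g : C(ℝ≥0, ℝ) | ∀ x ∈ Icc (0 : ℝ≥0) (n + 1), dist (g x) (f x) < δ} ∈ 𝓝 f := by
    have h := (ContinuousMap.tendsto_iff_forall_isCompact_tendstoUniformlyOn (F := id) (p := 𝓝 f)
      (f := f)).1 tendsto_id (Icc (0 : ℝ≥0) (n + 1)) isCompact_Icc
    rw [Metric.tendstoUniformlyOn_iff] at h
    filter_upwards [h δ hδ] with g hg x hx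
    simpa [dist_comm] using hg x hx
  obtain ⟨g, ⟨k, rfl⟩, hg⟩ :=
    (TopologicalSpace.denseRange_denseSeq C(ℝ≥0, ℝ)).inter_nhds_nonempty hU
  refine ⟨k, fun x hx => ?_⟩
  have := hg x ⟨zero_le, by exact_mod_cast hx⟩
  rw [← Real.dist_eq, dist_comm]
  exact this

/-- Split f - χg = χ(f - g) + (1 - χ)f with χ the cutoff. The tail is controlled by the mass minus
the integral of χ, quantities that `testIntegrals` already records. -/
lemma abs_integral_sub_cutoffMul_le (ζ : Measure ℝ≥0) [IsFiniteMeasure ζ]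
    (f : BoundedContinuousFunction ℝ≥0 ℝ) (g : C(ℝ≥0, ℝ)) (n : ℕ) {δ : ℝ} (hδ : 0 ≤ δ)
    (hg : ∀ x : ℝ≥0, (x : ℝ) ≤ n + 1 → |f x - g x| < δ) :
    |∫ x, f x ∂ζ - ∫ x, cutoffMul n g x ∂ζ|
      ≤ δ * ζ.real univ + ‖f‖ * (ζ.real univ - ∫ x, cutoff n x ∂ζ) := by
  have hi : Integrable (fun x => ‖f‖ * (1 - cutoff n x)) ζ :=
    ((integrable_const _).sub (integrable_cutoff n ζ)).const_mul _
  have hR : δ * ζ.real univ + ‖f‖ * (ζ.real univ - ∫ x, cutoff n x ∂ζ)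
      = ∫ x, (δ + ‖f‖ * (1 - cutoff n x)) ∂ζ := by
    rw [integral_add (integrable_const _) hi, integral_const_mul,
      integral_sub (integrable_const _) (integrable_cutoff n ζ)]
    simp [mul_comm]
  rw [← integral_sub (f.integrable ζ) ((cutoffMul n g).integrable ζ), hR]
  refine (abs_integral_le_integral_abs).trans (integral_mono_of_nonneg
    (.of_forall fun x => abs_nonneg _) ?_ (.of_forall fun x => ?_))
  · exact (integrable_const _).add hi
  · have h0 := cutoff_nonneg n x
    have h1 := cutoff_le_one n x
    have hf : |f x| ≤ ‖f‖ := f.norm_coe_le_norm x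
    have e : f x - cutoffMul n g x = cutoff n x * (f x - g x) + (1 - cutoff n x) * f x := by
      rw [cutoffMul_apply]; ring
    have hA : |cutoff n x * (f x - g x)| ≤ δ := by
      by_cases hx : (x : ℝ) ≤ n + 1
      · rw [abs_mul, abs_of_nonneg h0]
        exact (mul_le_of_le_one_left (abs_nonneg _) h1).trans (hg x hx).le
      · rw [cutoff_eq_zero (not_le.mp hx).le]; simpa
    have hB : |(1 - cutoff n x) * f x| ≤ ‖f‖ * (1 - cutoff n x) := by
      rw [abs_mul, abs_of_nonneg (by linarith), mul_comm]
      gcongr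
    calc |f x - cutoffMul n g x| ≤ |cutoff n x * (f x - g x)| + |(1 - cutoff n x) * f x| := by
          rw [e]; exact abs_add_le _ _
      _ ≤ _ := add_le_add hA hB

/-- Convergence of the mass and of the cutoff integrals prevents mass from escaping to infinity; on
the compact set that remains, a dense sequence of test functions suffices. -/
theorem isInducing_testIntegrals : IsInducing testIntegrals := by
  refine isInducing_iff_nhds.2 fun ζ => le_antisymm
    (continuous_testIntegrals.tendsto ζ).le_comap ?_
  set F := comap testIntegrals (𝓝 (testIntegrals ζ)) with hF
  change Tendsto id F (𝓝 ζ)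
  have hT : Tendsto testIntegrals F (𝓝 (testIntegrals ζ)) := tendsto_comap
  rw [FiniteMeasure.tendsto_iff_forall_integral_tendsto]
  intro f
  have h1 (n : ℕ) : Tendsto (fun η : FiniteMeasure ℝ≥0 => ∫ x, cutoff n x ∂(η : Measure ℝ≥0)) F
      (𝓝 (∫ x, cutoff n x ∂(ζ : Measure ℝ≥0))) := by
    have := ((continuous_apply n).comp continuous_fst).continuousAt.tendsto.comp hT
    simpa [testIntegrals, Function.comp_def] using this
  have h2 (n k : ℕ) : Tendsto (fun η : FiniteMeasure ℝ≥0 =>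
      ∫ x, cutoffMul n (TopologicalSpace.denseSeq C(ℝ≥0, ℝ) k) x ∂(η : Measure ℝ≥0)) F
      (𝓝 (∫ x, cutoffMul n (TopologicalSpace.denseSeq C(ℝ≥0, ℝ) k) x ∂(ζ : Measure ℝ≥0))) :=
    ((continuous_apply (n, k)).comp
      (continuous_fst.comp continuous_snd)).continuousAt.tendsto.comp hT
  have h3 : Tendsto (fun η : FiniteMeasure ℝ≥0 => (η : Measure ℝ≥0).real univ) F
      (𝓝 ((ζ : Measure ℝ≥0).real univ)) :=
    (continuous_snd.comp continuous_snd).continuousAt.tendsto.comp hT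
  rw [Metric.tendsto_nhds]
  intro ε hε
  set m := (ζ : Measure ℝ≥0).real univ with hm
  have hm0 : 0 ≤ m := measureReal_nonneg
  -- The two error terms at ζ are each made smaller than ε/8, so that the total stays below ε/4 at
  -- nearby η; the remaining part of ε covers the integral of the test function.
  obtain ⟨δ, hδ, hδm⟩ : ∃ δ > 0, δ * m < ε / 8 := by
    refine ⟨ε / 8 / (m + 1), by positivity, ?_⟩
    rw [div_mul_eq_mul_div, div_lt_iff₀ (by linarith)]
    nlinarith
  obtain ⟨n, hn⟩ : ∃ n, ‖f‖ * (m - ∫ x, cutoff n x ∂(ζ : Measure ℝ≥0)) < ε / 8 := by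
    have : Tendsto (fun n => ‖f‖ * (m - ∫ x, cutoff n x ∂(ζ : Measure ℝ≥0))) atTop (𝓝 0) := by
      have := ((tendsto_integral_cutoff (ζ : Measure ℝ≥0)).const_sub m).const_mul ‖f‖
      simpa [hm] using this
    exact (this.eventually_lt_const (by positivity)).exists
  obtain ⟨k, hk⟩ := exists_denseSeq_dist_le f.toContinuousMap n hδ
  set g := TopologicalSpace.denseSeq C(ℝ≥0, ℝ) k
  have hR : Tendsto (fun η : FiniteMeasure ℝ≥0 => δ * (η : Measure ℝ≥0).real univ
      + ‖f‖ * ((η : Measure ℝ≥0).real univ - ∫ x, cutoff n x ∂(η : Measure ℝ≥0))) F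
      (𝓝 (δ * m + ‖f‖ * (m - ∫ x, cutoff n x ∂(ζ : Measure ℝ≥0)))) :=
    (h3.const_mul δ).add ((h3.sub (h1 n)).const_mul _)
  filter_upwards [hR.eventually_lt_const (show _ < ε / 4 by linarith),
    Metric.tendsto_nhds.1 (h2 n k) (ε / 4) (by positivity)] with η hη1 hη2
  have a1 := abs_integral_sub_cutoffMul_le (η : Measure ℝ≥0) f g n hδ.le hk
  have a2 := abs_integral_sub_cutoffMul_le (ζ : Measure ℝ≥0) f g n hδ.le hk
  rw [Real.dist_eq] at hη2 ⊢
  simp only [id]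
  rw [abs_lt] at hη2 ⊢
  rw [abs_le] at a1 a2
  constructor <;> linarith [a1.1, a1.2, a2.1, a2.2, hη2.1, hη2.2]

lemma measurable_integral_finiteMeasure (f : BoundedContinuousFunction ℝ≥0 ℝ) :
    Measurable fun ζ : FiniteMeasure ℝ≥0 => ∫ x, f x ∂(ζ : Measure ℝ≥0) := by
  have h : Measurable fun ζ : FiniteMeasure ℝ≥0 => (ζ : Measure ℝ≥0) := measurable_subtype_coe
  have e (ζ : FiniteMeasure ℝ≥0) : ∫ x, f x ∂(ζ : Measure ℝ≥0)
      = (∫⁻ x, ENNReal.ofReal (f x) ∂(ζ : Measure ℝ≥0)).toReal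
        - (∫⁻ x, ENNReal.ofReal (-f x) ∂(ζ : Measure ℝ≥0)).toReal :=
    integral_eq_lintegral_pos_part_sub_lintegral_neg_part (f.integrable _)
  simp_rw [e]
  exact (((Measure.measurable_lintegral (by fun_prop)).comp h).ennreal_toReal).sub
    (((Measure.measurable_lintegral (by fun_prop)).comp h).ennreal_toReal)

/-- Weakly open sets of finite measures are measurable for the `σ`-algebra generated by the
evaluations. -/
instance : OpensMeasurableSpace (FiniteMeasure ℝ≥0) where
  borel_le := by
    have h : Measurable testIntegrals := by
      refine (measurable_pi_iff.2 fun n => ?_).prodMk ((measurable_pi_iff.2 fun p => ?_).prodMk ?_)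
      · exact measurable_integral_finiteMeasure _
      · exact measurable_integral_finiteMeasure _
      · exact ((Measure.measurable_coe MeasurableSet.univ).comp
          measurable_subtype_coe).ennreal_toReal
    -- The target is a countable product of lines, where the Borel and product σ-algebras agree.
    rw [isInducing_testIntegrals.eq_induced, borel_comap]
    rintro s ⟨u, hu, rfl⟩
    have : MeasurableSet u := by
      rwa [← BorelSpace.measurable_eq (α := (ℕ → ℝ) × (ℕ × ℕ → ℝ) × ℝ)] at hu
    exact h this

/-! ### The space of continuous functions on the half-line -/

noncomputable instance instMeasurableSpacePath : MeasurableSpace C(ℝ≥0, ℝ) := borel _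

instance : BorelSpace C(ℝ≥0, ℝ) := ⟨rfl⟩

/-- The restriction of a path to a countable dense set, paired with an additional number. -/
noncomputable def evalDense (p : C(ℝ≥0, ℝ) × ℝ) : (ℕ → ℝ) × ℝ :=
  (fun n => p.1 (TopologicalSpace.denseSeq ℝ≥0 n), p.2)

/-- A continuous injection of a Polish space has measurable images (Lusin–Souslin). Thus
measurability and laws of random paths can be checked on countably many values. -/
lemma measurableEmbedding_evalDense : MeasurableEmbedding evalDense := by
  refine Continuous.measurableEmbedding (by unfold evalDense; fun_prop) ?_
  rintro ⟨f, x⟩ ⟨g, y⟩ h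
  simp only [evalDense, Prod.mk.injEq] at h
  refine Prod.ext (ContinuousMap.ext fun a => ?_) h.2
  have := DenseRange.equalizer (TopologicalSpace.denseRange_denseSeq ℝ≥0) f.continuous
    g.continuous h.1
  exact congrFun this a

end RCBM

namespace RCBM

/-! ### Random paths: measurability, equality of laws, convergence in distribution -/

section RandomPaths

variable {Ω : Type*} [MeasurableSpace Ω] {P : Measure Ω}

lemma toPath_apply {f : ℝ≥0∞ → ℝ} (hf : Continuous fun a : ℝ≥0 => f a) (a : ℝ≥0) :
    toPath f a = f a := by
  simp [toPath, hf]

/-- The values of a function on `[0, ∞]` at countably many points, `∞` included. -/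
noncomputable def denseValues (f : ℝ≥0∞ → ℝ) : (ℕ → ℝ) × ℝ :=
  (fun n => f (TopologicalSpace.denseSeq ℝ≥0 n), f ∞)

lemma evalDense_toPath {f : ℝ≥0∞ → ℝ} (hf : Continuous fun a : ℝ≥0 => f a) :
    evalDense (toPath f, f ∞) = denseValues f := by
  simp [evalDense, denseValues, toPath_apply hf]

lemma aemeasurable_toPath {f : Ω → ℝ≥0∞ → ℝ}
    (hm : ∀ a : ℝ≥0, AEMeasurable (fun ω => f ω a) P)
    (hc : ∀ᵐ ω ∂P, Continuous fun a : ℝ≥0 => f ω a) :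
    AEMeasurable (fun ω => toPath (f ω)) P := by
  -- The second coordinate is a dummy that fits the path into the domain of `evalDense`.
  have h : AEMeasurable (fun ω => (toPath (f ω), (0 : ℝ))) P := by
    rw [← measurableEmbedding_evalDense.aemeasurable_comp_iff]
    have : AEMeasurable (fun ω => ((fun n => f ω (TopologicalSpace.denseSeq ℝ≥0 n) : ℕ → ℝ),
        (0 : ℝ))) P :=
      (aemeasurable_pi_lambda _ fun n => hm _).prodMk aemeasurable_const
    refine this.congr ?_
    filter_upwards [hc] with ω hω
    simp [evalDense, toPath_apply hω]
  exact measurable_fst.comp_aemeasurable h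

/-- A measurable left inverse of `evalDense` recovers the path, almost surely, from its countably
many values. -/
lemma identDistrib_toPath {f g : Ω → ℝ≥0∞ → ℝ}
    (h : IdentDistrib (fun ω => denseValues (f ω)) (fun ω => denseValues (g ω)) P P)
    (hf : ∀ᵐ ω ∂P, Continuous fun a : ℝ≥0 => f ω a)
    (hg : ∀ᵐ ω ∂P, Continuous fun a : ℝ≥0 => g ω a) :
    IdentDistrib (fun ω => (toPath (f ω), f ω ∞)) (fun ω => (toPath (g ω), g ω ∞)) P P := by
  obtain ⟨r, hr, hre⟩ := measurableEmbedding_evalDense.exists_measurable_extend measurable_id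
    (fun _ => inferInstance)
  have key {f : Ω → ℝ≥0∞ → ℝ} (hf : ∀ᵐ ω ∂P, Continuous fun a : ℝ≥0 => f ω a) :
      (fun ω => r (denseValues (f ω))) =ᵐ[P] fun ω => (toPath (f ω), f ω ∞) := by
    filter_upwards [hf] with ω hω
    rw [← evalDense_toPath hω]
    exact congrFun hre _
  have h' := h.comp hr
  refine ⟨h'.aemeasurable_fst.congr (key hf), h'.aemeasurable_snd.congr (key hg), ?_⟩
  rw [← Measure.map_congr (key hf), ← Measure.map_congr (key hg)]
  exact h'.map_eq

/-- Convergence in distribution only sees the law at each time separately; `Y` and `Y'` need not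
agree in law as processes in t. -/
lemma tendstoInDistribution_of_identDistrib_of_ae_tendsto [IsProbabilityMeasure P] {S : Type*}
    [TopologicalSpace S] [MeasurableSpace S] [OpensMeasurableSpace S] {Y Y' : ℝ≥0 → Ω → S}
    {Z : Ω → S} (h : ∀ t, IdentDistrib (Y t) (Y' t) P P) (hZ : AEMeasurable Z P)
    (hlim : ∀ᵐ ω ∂P, Tendsto (fun t => Y' t ω) atTop (𝓝 (Z ω))) :
    TendstoInDistribution Y atTop Z (fun _ => P) P := by
  have h2 := tendstoInDistribution_of_ae_tendsto (fun t => (h t).aemeasurable_snd) hZ hlim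
  exact ⟨fun t => (h t).aemeasurable_fst, hZ,
    h2.tendsto.congr fun t => Subtype.ext (h t).map_eq.symm⟩

/-- `ConvergesInDistribution` fixes the Borel σ-algebra, whereas the ambient one may be finer; the
identity from the finer to the Borel one is measurable and transports the hypotheses. -/
lemma convergesInDistribution_of_identDistrib [IsProbabilityMeasure P] {S : Type*}
    [TopologicalSpace S] [mS : MeasurableSpace S] [oS : OpensMeasurableSpace S]
    {Y Y' : ℝ≥0 → Ω → S} {Z : Ω → S} (h : ∀ t, IdentDistrib (Y t) (Y' t) P P)
    (hZ : AEMeasurable Z P) (hlim : ∀ᵐ ω ∂P, Tendsto (fun t => Y' t ω) atTop (𝓝 (Z ω))) :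
    ConvergesInDistribution P Y Z := by
  have hid : @Measurable S S mS (borel S) id := fun s hs => oS.borel_le s hs
  exact @tendstoInDistribution_of_identDistrib_of_ae_tendsto Ω _ P _ S _ (borel S)
    (@BorelSpace.opensMeasurable S _ (borel S) (@BorelSpace.mk S _ (borel S) rfl)) Y Y' Z
    (fun t => @IdentDistrib.comp Ω Ω S S _ _ mS (borel S) P P (Y t) (Y' t) id (h t) hid)
    (@Measurable.comp_aemeasurable Ω S S _ (borel S) P mS Z id hid hZ) hlim

end RandomPaths

/-! ### Measures associated with monotone functions -/

section Associated

/-- The functions which have an associated measure. -/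
structure IsAdmissible (f : ℝ≥0∞ → ℝ) : Prop where
  continuous : Continuous fun a : ℝ≥0 => f a
  monotone : Monotone fun a : ℝ≥0 => f a
  zero : f 0 = 0
  lintegral_lt_top : (∫⁻ x in Ioi (0 : ℝ), ENNReal.ofReal (f (ENNReal.ofReal x) / x ^ 2)) < ∞

variable {f : ℝ≥0∞ → ℝ}

namespace IsAdmissible

lemma continuous_ofReal (hf : IsAdmissible f) : Continuous fun x : ℝ => f (ENNReal.ofReal x) :=
  hf.continuous.comp continuous_real_toNNReal

lemma monotone_ofReal (hf : IsAdmissible f) : Monotone fun x : ℝ => f (ENNReal.ofReal x) :=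
  fun _ _ hxy => hf.monotone (Real.toNNReal_le_toNNReal hxy)

lemma ofReal_eq_zero (hf : IsAdmissible f) {x : ℝ} (hx : x ≤ 0) : f (ENNReal.ofReal x) = 0 := by
  rw [ENNReal.ofReal_of_nonpos hx, hf.zero]

lemma ofReal_nonneg (hf : IsAdmissible f) (x : ℝ) : 0 ≤ f (ENNReal.ofReal x) := by
  rcases le_total x 0 with hx | hx
  · exact (hf.ofReal_eq_zero hx).ge
  · simpa [hf.zero] using hf.monotone_ofReal hx

lemma measurable_density (hf : IsAdmissible f) :
    Measurable fun x : ℝ => f (ENNReal.ofReal x) / x ^ 2 :=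
  hf.continuous_ofReal.measurable.div (by fun_prop)

lemma density_nonneg (hf : IsAdmissible f) (x : ℝ) : 0 ≤ f (ENNReal.ofReal x) / x ^ 2 :=
  div_nonneg (hf.ofReal_nonneg x) (sq_nonneg x)

lemma integrable_density (hf : IsAdmissible f) :
    Integrable fun x : ℝ => f (ENNReal.ofReal x) / x ^ 2 := by
  have h : IntegrableOn (fun x : ℝ => f (ENNReal.ofReal x) / x ^ 2) (Ioi 0) := by
    refine ⟨hf.measurable_density.aestronglyMeasurable, ?_⟩
    rw [hasFiniteIntegral_iff_ofReal (.of_forall hf.density_nonneg)]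
    exact hf.lintegral_lt_top
  rw [← integrableOn_univ]
  refine h.of_forall_sdiff_eq_zero MeasurableSet.univ fun x hx => ?_
  rw [hf.ofReal_eq_zero (not_lt.mp hx.2), zero_div]

/-- The primitive of `f(x) / x²`. -/
noncomputable def primitive (f : ℝ≥0∞ → ℝ) (a : ℝ) : ℝ :=
  ∫ x in (0 : ℝ)..a, f (ENNReal.ofReal x) / x ^ 2

lemma continuous_primitive (hf : IsAdmissible f) : Continuous (primitive f) :=
  intervalIntegral.continuous_primitive (fun _ _ => hf.integrable_density.intervalIntegrable) 0

lemma primitive_of_nonpos (hf : IsAdmissible f) {a : ℝ} (ha : a ≤ 0) : primitive f a = 0 := by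
  unfold primitive
  rw [intervalIntegral.integral_congr (g := fun _ => (0 : ℝ)), intervalIntegral.integral_zero]
  intro x hx
  rw [uIcc_of_ge ha] at hx
  simp [hf.ofReal_eq_zero hx.2]

lemma primitive_nonneg (hf : IsAdmissible f) {a : ℝ} (ha : 0 ≤ a) : 0 ≤ primitive f a :=
  intervalIntegral.integral_nonneg ha fun x _ => hf.density_nonneg x

/-- On [a, b] the integrand is at least f(a)/x², by monotonicity. This one bound gives both the
monotonicity of the distribution function and the control of f(a)/a. -/
lemma le_primitive_sub (hf : IsAdmissible f) {a b : ℝ} (ha : 0 < a) (hab : a ≤ b) :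
    f (ENNReal.ofReal a) * (1 / a - 1 / b) ≤ primitive f b - primitive f a := by
  have hi (a b : ℝ) : IntervalIntegrable (fun x : ℝ => f (ENNReal.ofReal x) / x ^ 2) volume a b :=
    hf.integrable_density.intervalIntegrable
  have h0 : ∀ x ∈ uIcc a b, x ≠ 0 := fun x hx => by
    rw [uIcc_of_le hab] at hx
    exact (ha.trans_le hx.1).ne'
  have hd : ∀ x ∈ uIcc a b,
      HasDerivAt (fun x : ℝ => -(f (ENNReal.ofReal a) * x⁻¹)) (f (ENNReal.ofReal a) / x ^ 2) x := by
    intro x hx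
    refine ((hasDerivAt_inv (h0 x hx)).const_mul (f (ENNReal.ofReal a))).neg.congr_deriv ?_
    field_simp
  have hc : ContinuousOn (fun x : ℝ => f (ENNReal.ofReal a) / x ^ 2) (uIcc a b) :=
    continuousOn_const.div (by fun_prop) fun x hx => pow_ne_zero 2 (h0 x hx)
  have e := intervalIntegral.integral_eq_sub_of_hasDerivAt hd hc.intervalIntegrable
  rw [primitive, primitive, intervalIntegral.integral_interval_sub_left (hi _ _) (hi _ _)]
  calc f (ENNReal.ofReal a) * (1 / a - 1 / b)
      = ∫ x in a..b, f (ENNReal.ofReal a) / x ^ 2 := by rw [e]; ring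
    _ ≤ _ := by
      refine intervalIntegral.integral_mono_on hab hc.intervalIntegrable (hi _ _) fun x hx => ?_
      gcongr
      exact hf.monotone_ofReal hx.1

/-- Take b = 2a. The right side vanishes as a tends to 0 or to ∞, so the boundary term f(a)/a does
too. -/
lemma div_le_primitive_sub (hf : IsAdmissible f) (a : ℝ) :
    f (ENNReal.ofReal a) / a ≤ 2 * (primitive f (2 * a) - primitive f a) := by
  rcases le_or_gt a 0 with ha | ha
  · rw [hf.ofReal_eq_zero ha, hf.primitive_of_nonpos ha, hf.primitive_of_nonpos (by linarith)]
    simp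
  · have := hf.le_primitive_sub ha (show a ≤ 2 * a by linarith)
    have e : f (ENNReal.ofReal a) * (1 / a - 1 / (2 * a)) = f (ENNReal.ofReal a) / a / 2 := by
      field_simp; ring
    linarith

lemma div_nonneg' (hf : IsAdmissible f) (a : ℝ) : 0 ≤ f (ENNReal.ofReal a) / a := by
  rcases le_total a 0 with ha | ha
  · rw [hf.ofReal_eq_zero ha, zero_div]
  · exact div_nonneg (hf.ofReal_nonneg a) ha

/-- The distribution function of the associated measure. -/
noncomputable def distFun (f : ℝ≥0∞ → ℝ) (a : ℝ) : ℝ := primitive f a + f (ENNReal.ofReal a) / a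

lemma distFun_of_nonpos (hf : IsAdmissible f) {a : ℝ} (ha : a ≤ 0) : distFun f a = 0 := by
  rw [distFun, hf.primitive_of_nonpos ha, hf.ofReal_eq_zero ha, zero_div, add_zero]

lemma monotone_distFun (hf : IsAdmissible f) : Monotone (distFun f) := by
  intro a b hab
  rcases le_or_gt a 0 with ha | ha
  · rw [hf.distFun_of_nonpos ha]
    rcases le_or_gt b 0 with hb | hb
    · rw [hf.distFun_of_nonpos hb]
    · exact add_nonneg (hf.primitive_nonneg hb.le) (hf.div_nonneg' b)
  -- The primitive gains at least f(a)/a - f(a)/b, which compensates the possible decrease of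
  -- f(a)/a.
  · have h1 := hf.le_primitive_sub ha hab
    have hb : 0 < b := ha.trans_le hab
    have h2 : f (ENNReal.ofReal a) / b ≤ f (ENNReal.ofReal b) / b := by
      gcongr
      exact hf.monotone_ofReal hab
    have e : f (ENNReal.ofReal a) * (1 / a - 1 / b)
        = f (ENNReal.ofReal a) / a - f (ENNReal.ofReal a) / b := by ring
    unfold distFun
    linarith

lemma continuous_distFun (hf : IsAdmissible f) : Continuous (distFun f) := by
  refine hf.continuous_primitive.add (continuous_iff_continuousAt.2 fun a => ?_)
  rcases eq_or_ne a 0 with rfl | ha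
  · have h : Tendsto (fun a => 2 * (primitive f (2 * a) - primitive f a)) (𝓝 0) (𝓝 0) := by
      have hc : Continuous fun a => 2 * (primitive f (2 * a) - primitive f a) :=
        ((hf.continuous_primitive.comp (by fun_prop : Continuous fun a : ℝ => 2 * a)).sub
          hf.continuous_primitive).const_mul 2 |> fun h => by simpa using h
      simpa using hc.tendsto 0
    rw [ContinuousAt, div_zero]
    exact tendsto_of_tendsto_of_tendsto_of_le_of_le tendsto_const_nhds h hf.div_nonneg'
      hf.div_le_primitive_sub
  · exact hf.continuous_ofReal.continuousAt.div continuousAt_id ha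

lemma tendsto_primitive (hf : IsAdmissible f) : Tendsto (primitive f) atTop
    (𝓝 (∫ x in Ioi (0 : ℝ), f (ENNReal.ofReal x) / x ^ 2)) :=
  intervalIntegral_tendsto_integral_Ioi 0 hf.integrable_density.integrableOn tendsto_id

lemma tendsto_distFun (hf : IsAdmissible f) : Tendsto (distFun f) atTop
    (𝓝 (∫ x in Ioi (0 : ℝ), f (ENNReal.ofReal x) / x ^ 2)) := by
  have h2 : Tendsto (fun a : ℝ => 2 * a) atTop atTop := tendsto_id.const_mul_atTop (by norm_num)
  have h : Tendsto (fun a => 2 * (primitive f (2 * a) - primitive f a)) atTop (𝓝 0) := by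
    simpa using ((hf.tendsto_primitive.comp h2).sub hf.tendsto_primitive).const_mul 2
  have h0 := tendsto_of_tendsto_of_tendsto_of_le_of_le tendsto_const_nhds h hf.div_nonneg'
      hf.div_le_primitive_sub
  rw [← add_zero (∫ x in Ioi (0 : ℝ), f (ENNReal.ofReal x) / x ^ 2)]
  exact hf.tendsto_primitive.add h0

/-- The distribution function of the associated measure, as a Stieltjes function. -/
noncomputable def stieltjes (hf : IsAdmissible f) : StieltjesFunction ℝ where
  toFun := distFun f
  mono' := hf.monotone_distFun
  right_continuous' _ := hf.continuous_distFun.continuousWithinAt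

lemma tendsto_stieltjes_atBot (hf : IsAdmissible f) : Tendsto hf.stieltjes atBot (𝓝 0) := by
  refine tendsto_const_nhds.congr' ?_
  filter_upwards [eventually_le_atBot 0] with a ha using (hf.distFun_of_nonpos ha).symm

lemma tendsto_stieltjes_atTop (hf : IsAdmissible f) : Tendsto hf.stieltjes atTop
    (𝓝 (∫ x in Ioi (0 : ℝ), f (ENNReal.ofReal x) / x ^ 2)) := hf.tendsto_distFun

/-- The measure associated with an admissible function. -/
noncomputable def measure (hf : IsAdmissible f) : FiniteMeasure ℝ≥0 :=
  ⟨hf.stieltjes.measure.map Real.toNNReal, by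
    have : IsFiniteMeasure hf.stieltjes.measure :=
      ⟨by rw [hf.stieltjes.measure_univ hf.tendsto_stieltjes_atBot hf.tendsto_stieltjes_atTop]
          exact ENNReal.ofReal_lt_top⟩
    infer_instance⟩

lemma measure_Iic (hf : IsAdmissible f) (a : ℝ≥0) :
    (hf.measure : Measure ℝ≥0) (Iic a) = ENNReal.ofReal (distFun f a) := by
  have h : Real.toNNReal ⁻¹' Iic a = Iic (a : ℝ) := by
    ext x
    simp [Real.toNNReal_le_iff_le_coe]
  change (hf.stieltjes.measure.map Real.toNNReal) (Iic a) = _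
  rw [Measure.map_apply (by fun_prop) measurableSet_Iic, h,
    hf.stieltjes.measure_Iic hf.tendsto_stieltjes_atBot, sub_zero]
  rfl

lemma isAssociatedMeasure (hf : IsAdmissible f) : IsAssociatedMeasure f hf.measure where
  zero := by
    have h : {0} = Iic (0 : ℝ≥0) := by ext; simp
    rw [h, hf.measure_Iic]
    simp [hf.distFun_of_nonpos le_rfl]
  Icc a ha := by
    rw [← bot_eq_zero, Icc_bot, hf.measure_Iic, distFun,
      ENNReal.ofReal_add (hf.primitive_nonneg a.coe_nonneg) (hf.div_nonneg' a), primitive,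
      intervalIntegral.integral_of_le a.coe_nonneg, ofReal_integral_eq_lintegral_ofReal
        hf.integrable_density.integrableOn (.of_forall hf.density_nonneg)]
    simp
  univ := by
    change (hf.stieltjes.measure.map Real.toNNReal) Set.univ = _
    rw [Measure.map_apply (by fun_prop) MeasurableSet.univ, preimage_univ,
      hf.stieltjes.measure_univ hf.tendsto_stieltjes_atBot hf.tendsto_stieltjes_atTop, sub_zero,
      ofReal_integral_eq_lintegral_ofReal
        hf.integrable_density.integrableOn (.of_forall hf.density_nonneg)]

end IsAdmissible

lemma IsAssociatedMeasure.unique {ζ η : FiniteMeasure ℝ≥0} (hζ : IsAssociatedMeasure f ζ)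
    (hη : IsAssociatedMeasure f η) : ζ = η := by
  refine FiniteMeasure.toMeasure_injective (Measure.ext_of_Iic _ _ fun a => ?_)
  rcases eq_or_ne a 0 with rfl | ha
  · have h : (Iic (0 : ℝ≥0)) = {0} := by ext; simp
    rw [h, hζ.zero, hη.zero]
  · have h : Iic a = Set.Icc 0 a := by ext; simp
    rw [h, hζ.Icc a (pos_iff_ne_zero.2 ha), hη.Icc a (pos_iff_ne_zero.2 ha)]

lemma IsAdmissible.existsUnique (hf : IsAdmissible f) : ∃! ζ, IsAssociatedMeasure f ζ :=
  ⟨hf.measure, hf.isAssociatedMeasure, fun _ h => h.unique hf.isAssociatedMeasure⟩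

lemma IsAdmissible.associatedMeasure_spec (hf : IsAdmissible f) :
    IsAssociatedMeasure f (associatedMeasure f) := by
  have h : ∃ ζ, IsAssociatedMeasure f ζ := hf.existsUnique.exists
  rw [associatedMeasure, dif_pos h]
  exact h.choose_spec

/-- The value at ∞ plays no role, so a function may be replaced by the extension of its path. -/
lemma IsAssociatedMeasure.congr {g : ℝ≥0∞ → ℝ} {ζ : FiniteMeasure ℝ≥0}
    (h : IsAssociatedMeasure f ζ) (hfg : ∀ a : ℝ≥0, f a = g a) : IsAssociatedMeasure g ζ where
  zero := h.zero
  Icc a ha := by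
    rw [h.Icc a ha, hfg a]
    congr 1
    simp only [ENNReal.ofReal, hfg]
  univ := by
    rw [h.univ]
    simp only [ENNReal.ofReal, hfg]

end Associated

end RCBM

namespace RCBM

/-! ### Measurability and weak convergence of associated measures -/

/-- A path regarded as a function on `[0, ∞]`. -/
def extendPath (g : C(ℝ≥0, ℝ)) (a : ℝ≥0∞) : ℝ := g a.toNNReal

lemma extendPath_toPath {f : ℝ≥0∞ → ℝ} (hf : Continuous fun a : ℝ≥0 => f a) (a : ℝ≥0) :
    extendPath (toPath f) a = f a := by
  rw [extendPath, ENNReal.toNNReal_coe, toPath_apply hf]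

lemma IsAdmissible.congr {f g : ℝ≥0∞ → ℝ} (hf : IsAdmissible f) (hfg : ∀ a : ℝ≥0, f a = g a) :
    IsAdmissible g where
  continuous := by simpa only [hfg] using hf.continuous
  monotone := by simpa only [hfg] using hf.monotone
  zero := by simpa [hf.zero] using (hfg 0).symm
  lintegral_lt_top := by simpa only [ENNReal.ofReal, hfg] using hf.lintegral_lt_top

lemma IsAdmissible.extendPath_toPath {f : ℝ≥0∞ → ℝ} (hf : IsAdmissible f) :
    IsAdmissible (extendPath (toPath f)) :=
  hf.congr fun a => (RCBM.extendPath_toPath hf.continuous a).symm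

lemma IsAdmissible.associatedMeasure_extendPath {f : ℝ≥0∞ → ℝ} (hf : IsAdmissible f) :
    associatedMeasure (extendPath (toPath f)) = associatedMeasure f :=
  (hf.extendPath_toPath.associatedMeasure_spec.congr
    (RCBM.extendPath_toPath hf.continuous)).unique hf.associatedMeasure_spec

lemma measurable_eval_path : Measurable fun p : C(ℝ≥0, ℝ) × ℝ => p.1 p.2.toNNReal := by
  have : Continuous fun p : C(ℝ≥0, ℝ) × ℝ => p.1 p.2.toNNReal := by fun_prop
  exact this.measurable

lemma measurable_lintegral_path (s : Set ℝ) : Measurable fun g : C(ℝ≥0, ℝ) =>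
    ∫⁻ x in s, ENNReal.ofReal (g x.toNNReal / x ^ 2) :=
  Measurable.lintegral_prod_right' (ν := volume.restrict s)
    (f := fun p : C(ℝ≥0, ℝ) × ℝ => ENNReal.ofReal (p.1 p.2.toNNReal / p.2 ^ 2))
    (measurable_eval_path.div (measurable_snd.pow_const 2)).ennreal_ofReal

lemma measurableSet_isAdmissible : MeasurableSet {g : C(ℝ≥0, ℝ) | IsAdmissible (extendPath g)} := by
  have e : {g : C(ℝ≥0, ℝ) | IsAdmissible (extendPath g)}
      = {g : C(ℝ≥0, ℝ) | Monotone g} ∩ {g | g 0 = 0} ∩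
        {g | (∫⁻ x in Ioi (0 : ℝ), ENNReal.ofReal (g x.toNNReal / x ^ 2)) < ∞} := by
    ext g
    constructor
    · exact fun h => ⟨⟨h.monotone, h.zero⟩, h.lintegral_lt_top⟩
    · exact fun h => ⟨g.continuous, h.1.1, h.1.2, h.2⟩
  rw [e]
  refine ((IsClosed.measurableSet ?_).inter (IsClosed.measurableSet ?_)).inter
    (measurableSet_lt (measurable_lintegral_path _) measurable_const)
  · simp only [Monotone, ofPred_forall]
    exact isClosed_iInter fun a => isClosed_iInter fun b => isClosed_iInter fun _ =>
      isClosed_le (by fun_prop) (by fun_prop)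
  · exact isClosed_eq (by fun_prop) continuous_const

open scoped Classical in
/-- The associated measure as a function of an admissible path. -/
noncomputable def pathMeasure (g : C(ℝ≥0, ℝ)) : FiniteMeasure ℝ≥0 :=
  if IsAdmissible (extendPath g) then associatedMeasure (extendPath g) else 0

lemma IsAdmissible.pathMeasure_toPath {f : ℝ≥0∞ → ℝ} (hf : IsAdmissible f) :
    pathMeasure (toPath f) = associatedMeasure f := by
  rw [pathMeasure, if_pos hf.extendPath_toPath, hf.associatedMeasure_extendPath]

/-- The half-lines `Iic a` form a generating π-system, and on them and on the whole space the
measure is an explicit measurable functional of the path. -/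
lemma measurable_pathMeasure : Measurable pathMeasure := by
  refine Measurable.subtype_mk (p := fun μ : Measure ℝ≥0 => IsFiniteMeasure μ)
    (f := fun g => (pathMeasure g : Measure ℝ≥0)) (h := fun g => (pathMeasure g).2) ?_
  have hite (s : Set ℝ≥0) (F : C(ℝ≥0, ℝ) → ℝ≥0∞) (hF : Measurable F)
      (h : ∀ g, IsAdmissible (extendPath g) →
        (associatedMeasure (extendPath g) : Measure ℝ≥0) s = F g) :
      Measurable fun g => (pathMeasure g : Measure ℝ≥0) s := by
    classical
    have : (fun g => (pathMeasure g : Measure ℝ≥0) s)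
        = fun g => if IsAdmissible (extendPath g) then F g else 0 := by
      funext g
      by_cases hg : IsAdmissible (extendPath g)
      · simp [pathMeasure, hg, h g hg]
      · simp [pathMeasure, hg]
    rw [this]
    exact Measurable.ite measurableSet_isAdmissible hF measurable_const
  refine Measurable.measure_of_isPiSystem (borel_eq_generateFrom_Iic ℝ≥0 ▸
    BorelSpace.measurable_eq) (@isPiSystem_Iic ℝ≥0 _) ?_ ?_
  · rintro s ⟨a, rfl⟩
    rcases eq_or_ne a 0 with rfl | ha
    · refine hite _ (fun _ => 0) measurable_const fun g hg => ?_
      have h : (Iic (0 : ℝ≥0)) = {0} := by ext; simp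
      rw [h, hg.associatedMeasure_spec.zero]
    · refine hite _ (fun g => (∫⁻ x in Ioc (0 : ℝ) a, ENNReal.ofReal (g x.toNNReal / x ^ 2))
        + ENNReal.ofReal (g a / a)) ?_ fun g hg => ?_
      · refine (measurable_lintegral_path _).add (Measurable.ennreal_ofReal ?_)
        have : Continuous fun g : C(ℝ≥0, ℝ) => g a / (a : ℝ) := by fun_prop
        exact this.measurable
      · have h : Iic a = Icc 0 a := by ext; simp
        rw [h, hg.associatedMeasure_spec.Icc a (pos_iff_ne_zero.2 ha)]
        rfl
  · exact hite _ _ (measurable_lintegral_path _) fun g hg => hg.associatedMeasure_spec.univ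

/-- The cutoff vanishes beyond n + 1, so only the restrictions to [0, n + 1] enter, and these are
determined by the given values. -/
lemma integral_cutoffMul_congr {ζ η : FiniteMeasure ℝ≥0} {n : ℕ} (g : C(ℝ≥0, ℝ))
    (h : ∀ a : ℝ≥0, a ≤ n + 1 → (ζ : Measure ℝ≥0) (Iic a) = (η : Measure ℝ≥0) (Iic a)) :
    ∫ x, cutoffMul n g x ∂(ζ : Measure ℝ≥0) = ∫ x, cutoffMul n g x ∂(η : Measure ℝ≥0) := by
  have hr : (ζ : Measure ℝ≥0).restrict (Iic (n + 1)) = (η : Measure ℝ≥0).restrict (Iic (n + 1)) := by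
    refine Measure.ext_of_Iic _ _ fun a => ?_
    rw [Measure.restrict_apply measurableSet_Iic, Measure.restrict_apply measurableSet_Iic,
      Iic_inter_Iic]
    exact h _ inf_le_right
  have e (ζ : FiniteMeasure ℝ≥0) : ∫ x, cutoffMul n g x ∂(ζ : Measure ℝ≥0)
      = ∫ x in Iic ((n : ℝ≥0) + 1), cutoffMul n g x ∂(ζ : Measure ℝ≥0) := by
    refine (setIntegral_eq_integral_of_forall_compl_eq_zero fun x hx => ?_).symm
    have hx' : (n : ℝ) + 1 ≤ x := by
      have := (not_le.mp (mem_Iic.not.mp hx)).le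
      exact_mod_cast this
    rw [cutoffMul_apply, cutoff_eq_zero hx', zero_mul]
  rw [e ζ, e η, hr]

/-- Finite measures converge weakly if they are eventually constant on bounded intervals and
their masses converge. -/
lemma tendsto_finiteMeasure_of_eventually_Iic_eq {ι : Type*} {l : Filter ι}
    {ζ : ι → FiniteMeasure ℝ≥0} {η : FiniteMeasure ℝ≥0}
    (hloc : ∀ A : ℝ≥0, ∀ᶠ i in l, ∀ a ≤ A,
      (ζ i : Measure ℝ≥0) (Iic a) = (η : Measure ℝ≥0) (Iic a))
    (hmass : Tendsto (fun i => (ζ i : Measure ℝ≥0) univ) l (𝓝 ((η : Measure ℝ≥0) univ))) :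
    Tendsto ζ l (𝓝 η) := by
  rw [isInducing_testIntegrals.tendsto_nhds_iff]
  refine (tendsto_pi_nhds.2 fun n => ?_).prodMk_nhds
    ((tendsto_pi_nhds.2 fun p => ?_).prodMk_nhds ?_)
  · refine tendsto_const_nhds.congr' ?_
    filter_upwards [hloc (n + 1)] with i hi using (integral_cutoffMul_congr _ hi).symm
  · refine tendsto_const_nhds.congr' ?_
    filter_upwards [hloc (p.1 + 1)] with i hi using (integral_cutoffMul_congr _ hi).symm
  · exact (ENNReal.tendsto_toReal (measure_ne_top _ _)).comp hmass

/-- Convergence of associated measures of functions that are eventually equal on bounded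
intervals and dominated. -/
lemma tendsto_associatedMeasure {F : ℝ≥0 → ℝ≥0∞ → ℝ} {f : ℝ≥0∞ → ℝ} {bd : ℝ → ℝ≥0∞}
    (hF : ∀ t, IsAdmissible (F t)) (hf : IsAdmissible f)
    (hloc : ∀ A : ℝ≥0, ∀ᶠ t in atTop, ∀ a : ℝ≥0, a ≤ A → F t a = f a)
    (hbd : ∀ t, ∀ x : ℝ, 0 < x → ENNReal.ofReal (F t (ENNReal.ofReal x) / x ^ 2) ≤ bd x)
    (hfin : (∫⁻ x in Ioi (0 : ℝ), bd x) ≠ ∞) :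
    Tendsto (fun t => associatedMeasure (F t)) atTop (𝓝 (associatedMeasure f)) := by
  refine tendsto_finiteMeasure_of_eventually_Iic_eq (fun A => ?_) ?_
  · filter_upwards [hloc A] with t ht a ha
    rcases eq_or_ne a 0 with rfl | ha0
    · have h : (Iic (0 : ℝ≥0)) = {0} := by ext; simp
      rw [h, (hF t).associatedMeasure_spec.zero, hf.associatedMeasure_spec.zero]
    · have h : Iic a = Icc 0 a := by ext; simp
      rw [h, (hF t).associatedMeasure_spec.Icc a (pos_iff_ne_zero.2 ha0),
        hf.associatedMeasure_spec.Icc a (pos_iff_ne_zero.2 ha0), ht a ha]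
      congr 1
      refine setLIntegral_congr_fun measurableSet_Ioc fun x hx => ?_
      have := ht x.toNNReal ((Real.toNNReal_le_iff_le_coe.2 hx.2).trans ha)
      simp only [ENNReal.ofReal, this]
  · simp only [(hF _).associatedMeasure_spec.univ, hf.associatedMeasure_spec.univ]
    refine tendsto_lintegral_filter_of_dominated_convergence bd
      (.of_forall fun t => (hF t).measurable_density.ennreal_ofReal)
      (.of_forall fun t => (ae_restrict_mem measurableSet_Ioi).mono (hbd t)) hfin ?_
    refine .of_forall fun x => tendsto_const_nhds.congr' ?_
    filter_upwards [hloc x.toNNReal] with t ht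
    simp only [ENNReal.ofReal, ht _ le_rfl]

end RCBM

namespace RCBM

/-! ### Drift functions -/

namespace IsDriftFunction

variable {μ : ℝ → ℝ}

lemma tendsto_driftAtInfty (hμ : IsDriftFunction μ) : Tendsto μ atTop (𝓝 (driftAtInfty μ)) := by
  -- Nothing is known of μ off (0, ∞); truncating the argument at 1 gives a function monotone on the
  -- whole line with the same limit.
  have ha : Antitone fun x : ℝ => μ (max x 1) := fun x y hxy =>
    hμ.strictAnti.antitoneOn (mem_Ioi.2 (lt_max_of_lt_right one_pos))
      (mem_Ioi.2 (lt_max_of_lt_right one_pos)) (max_le_max_right 1 hxy)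
  have hb : BddBelow (range fun x : ℝ => μ (max x 1)) :=
    ⟨0, by rintro _ ⟨x, rfl⟩; exact (hμ.pos _ (lt_max_of_lt_right one_pos)).le⟩
  have h : Tendsto μ atTop (𝓝 (⨅ x : ℝ, μ (max x 1))) := by
    refine (tendsto_atTop_ciInf ha hb).congr' ?_
    filter_upwards [eventually_ge_atTop 1] with x hx
    rw [max_eq_left hx]
  rw [driftAtInfty, h.limUnder_eq]
  exact h

lemma driftAtInfty_le (hμ : IsDriftFunction μ) {a : ℝ} (ha : 0 < a) : driftAtInfty μ ≤ μ a := by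
  refine le_of_tendsto hμ.tendsto_driftAtInfty ?_
  filter_upwards [eventually_ge_atTop a] with x hx
  exact hμ.strictAnti.antitoneOn ha (ha.trans_le hx) hx

lemma driftExt_anti (hμ : IsDriftFunction μ) {a b : ℝ≥0∞} (ha : a ≠ 0) (hab : a ≤ b) :
    driftExt μ b ≤ driftExt μ a := by
  rcases eq_or_ne b ∞ with rfl | hb
  · rcases eq_or_ne a ∞ with rfl | ha'
    · exact le_rfl
    · simpa [driftExt, ha'] using hμ.driftAtInfty_le (ENNReal.toReal_pos ha ha')
  · have ha' : a ≠ ∞ := ne_top_of_le_ne_top hb hab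
    simp only [driftExt, ha', hb, if_false]
    exact hμ.strictAnti.antitoneOn (ENNReal.toReal_pos ha ha')
      ((ENNReal.toReal_pos ha ha').trans_le (ENNReal.toReal_mono hb hab))
      (ENNReal.toReal_mono hb hab)

lemma driftExt_coe (a : ℝ≥0) : driftExt μ a = μ a := by simp [driftExt]

lemma driftExt_coe_pos (hμ : IsDriftFunction μ) {a : ℝ≥0} (ha : a ≠ 0) : 0 < driftExt μ a := by
  rw [driftExt_coe]
  exact hμ.pos _ (by positivity)

end IsDriftFunction

/-! ### Pathwise properties -/

/-- The paths of Brownian motion used in the pathwise arguments: continuous, started from zero,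
and bounded above after subtraction of any positive drift. -/
structure IsGoodPath (b : ℝ≥0 → ℝ) : Prop where
  continuous : Continuous b
  zero : b 0 = 0
  bddAbove : ∀ m : ℝ, 0 < m → BddAbove (range fun t : ℝ≥0 => b t - m * t)

variable {Ω : Type*} {σ : ℝ} {μ : ℝ → ℝ} {B : ℝ≥0 → Ω → ℝ} {w : ℝ≥0 → Ω → ℝ≥0} {ω : Ω}

@[simp] lemma X_apply_zero (t : ℝ≥0) : X σ μ B t 0 ω = 0 := by simp [X]

lemma X_of_ne_zero {a : ℝ≥0∞} (ha : a ≠ 0) (t : ℝ≥0) :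
    X σ μ B t a ω = σ * B t ω - driftExt μ a * t := by simp [X, ha]

lemma X_zero_time (hb : B 0 ω = 0) (a : ℝ≥0∞) : X σ μ B 0 a ω = 0 := by
  simp [X, hb]

lemma continuous_X (hb : Continuous fun t => B t ω) (a : ℝ≥0∞) :
    Continuous fun t => X σ μ B t a ω := by
  unfold X
  split_ifs
  · exact continuous_const
  · fun_prop

/-- The value a = 0 must be excluded, since X_t(0) = 0 may exceed X_t(c). Monotonicity on all of [0,
∞] returns for running maxima, which are nonnegative. -/
lemma X_mono (hμ : IsDriftFunction μ) (t : ℝ≥0) {a c : ℝ≥0∞} (ha : a ≠ 0) (hac : a ≤ c) :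
    X σ μ B t a ω ≤ X σ μ B t c ω := by
  rw [X_of_ne_zero ha, X_of_ne_zero (ne_bot_of_le_ne_bot ha hac)]
  have := hμ.driftExt_anti ha hac
  gcongr

lemma bddAbove_X (hb : IsGoodPath fun t => B t ω) (hσ : 0 < σ) {a : ℝ≥0∞}
    (ha : a ≠ 0 → 0 < driftExt μ a) : BddAbove (range fun t => X σ μ B t a ω) := by
  rcases eq_or_ne a 0 with rfl | ha0
  · simp [bddAbove_singleton]
  · obtain ⟨K, hK⟩ := hb.bddAbove (driftExt μ a / σ) (div_pos (ha ha0) hσ)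
    refine ⟨σ * K, ?_⟩
    rintro _ ⟨t, rfl⟩
    have := hK ⟨t, rfl⟩
    dsimp only at this ⊢
    rw [X_of_ne_zero ha0]
    calc σ * B t ω - driftExt μ a * t = σ * (B t ω - driftExt μ a / σ * t) := by field_simp
      _ ≤ σ * K := by gcongr

/-- Half of the drift keeps the path bounded above; the other half drives it to -∞. -/
lemma eventually_X_lt (hb : IsGoodPath fun t => B t ω) (hσ : 0 < σ) {a : ℝ≥0∞} (ha : a ≠ 0)
    (hd : 0 < driftExt μ a) (x : ℝ) : ∀ᶠ t in atTop, X σ μ B t a ω < x := by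
  obtain ⟨K, hK⟩ := hb.bddAbove (driftExt μ a / (2 * σ)) (by positivity)
  have h : Tendsto (fun t : ℝ≥0 => driftExt μ a / 2 * (t : ℝ)) atTop atTop :=
    NNReal.tendsto_coe_atTop.2 tendsto_id |>.const_mul_atTop (by positivity)
  filter_upwards [h.eventually_gt_atTop (σ * K - x)] with t ht
  have := hK ⟨t, rfl⟩
  dsimp only at this
  rw [X_of_ne_zero ha]
  have e : σ * B t ω - driftExt μ a * t
      = σ * (B t ω - driftExt μ a / (2 * σ) * t) - driftExt μ a / 2 * t := by field_simp; ring
  have : σ * (B t ω - driftExt μ a / (2 * σ) * t) ≤ σ * K := by gcongr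
  linarith

/-- The running maximum `sup_{s ≤ t} X_s(a)`. -/
noncomputable def runMax (σ : ℝ) (μ : ℝ → ℝ) (B : ℝ≥0 → Ω → ℝ) (t : ℝ≥0) (a : ℝ≥0∞) (ω : Ω) : ℝ :=
  sSup ((fun s => X σ μ B s a ω) '' Icc 0 t)

lemma le_runMax (hb : Continuous fun t => B t ω) {s t : ℝ≥0} (hst : s ≤ t) (a : ℝ≥0∞) :
    X σ μ B s a ω ≤ runMax σ μ B t a ω :=
  le_csSup (isCompact_Icc.image (continuous_X hb a)).bddAbove ⟨s, ⟨zero_le, hst⟩, rfl⟩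

lemma runMax_le {t : ℝ≥0} {a : ℝ≥0∞} {x : ℝ} (h : ∀ s ≤ t, X σ μ B s a ω ≤ x) :
    runMax σ μ B t a ω ≤ x :=
  csSup_le ⟨_, 0, ⟨le_rfl, zero_le⟩, rfl⟩ (by rintro _ ⟨s, hs, rfl⟩; exact h s hs.2)

lemma runMax_nonneg (hb : Continuous fun t => B t ω) (h0 : B 0 ω = 0) (t : ℝ≥0) (a : ℝ≥0∞) :
    0 ≤ runMax σ μ B t a ω :=
  (X_zero_time h0 a).ge.trans (le_runMax hb zero_le a)

lemma runMax_apply_zero (t : ℝ≥0) : runMax σ μ B t 0 ω = 0 := by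
  have : (Icc (0 : ℝ≥0) t).Nonempty := ⟨0, le_rfl, zero_le⟩
  simp [runMax, this]

lemma runMax_mono (hμ : IsDriftFunction μ) (hb : Continuous fun t => B t ω) (h0 : B 0 ω = 0)
    (t : ℝ≥0) : Monotone fun a => runMax σ μ B t a ω := by
  intro a c hac
  rcases eq_or_ne a 0 with rfl | ha
  · simp only [runMax_apply_zero]
    exact runMax_nonneg hb h0 t c
  · exact runMax_le fun s hs => (X_mono hμ s ha hac).trans (le_runMax hb hs c)

lemma le_Mstar (hb : IsGoodPath fun t => B t ω) (hσ : 0 < σ) {a : ℝ≥0∞}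
    (ha : a ≠ 0 → 0 < driftExt μ a) (t : ℝ≥0) : X σ μ B t a ω ≤ Mstar σ μ B a ω :=
  le_ciSup (bddAbove_X hb hσ ha) t

lemma Mstar_le {a : ℝ≥0∞} {x : ℝ} (h : ∀ t, X σ μ B t a ω ≤ x) : Mstar σ μ B a ω ≤ x :=
  ciSup_le h

lemma Mstar_nonneg (h0 : B 0 ω = 0) (a : ℝ≥0∞) : 0 ≤ Mstar σ μ B a ω := by
  by_cases h : BddAbove (range fun t => X σ μ B t a ω)
  · exact (X_zero_time h0 a).ge.trans (le_ciSup h 0)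
  · exact (Real.iSup_of_not_bddAbove h).ge

@[simp] lemma Mstar_apply_zero : Mstar σ μ B 0 ω = 0 := by simp [Mstar]

lemma runMax_le_Mstar (hb : IsGoodPath fun t => B t ω) (hσ : 0 < σ) {a : ℝ≥0∞}
    (ha : a ≠ 0 → 0 < driftExt μ a) (t : ℝ≥0) : runMax σ μ B t a ω ≤ Mstar σ μ B a ω :=
  runMax_le fun s _ => le_Mstar hb hσ ha s

lemma driftExt_pos_of_le (hμ : IsDriftFunction μ) {a c : ℝ≥0∞} (hd : 0 < driftExt μ c)
    (hac : a ≤ c) : a ≠ 0 → 0 < driftExt μ a :=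
  fun ha => hd.trans_le (hμ.driftExt_anti ha hac)

/-- The running maxima for all drifts larger than a given positive one are eventually equal to the
maxima. -/
lemma eventually_runMax_eq (hμ : IsDriftFunction μ) (hb : IsGoodPath fun t => B t ω) (hσ : 0 < σ)
    {c : ℝ≥0∞} (hc : c ≠ 0) (hd : 0 < driftExt μ c) :
    ∀ᶠ t in atTop, ∀ a ≤ c, runMax σ μ B t a ω = Mstar σ μ B a ω := by
  -- After T the path for c is negative, hence so are those for 0 < a ≤ c, and none of them can
  -- raise its maximum. One T serves all a.
  obtain ⟨T, hT⟩ := eventually_atTop.1 (eventually_X_lt (μ := μ) hb hσ hc hd 0)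
  filter_upwards [eventually_ge_atTop T] with t ht a hac
  refine le_antisymm (runMax_le_Mstar hb hσ (driftExt_pos_of_le hμ hd hac) t)
    (Mstar_le fun s => ?_)
  rcases eq_or_ne a 0 with rfl | ha
  · simp [runMax_apply_zero]
  rcases le_total s t with hst | hst
  · exact le_runMax hb.continuous hst a
  · exact ((X_mono hμ s ha hac).trans (hT s (ht.trans hst)).le).trans
      (runMax_nonneg hb.continuous hb.zero t a)

/-! ### Continuity in the parameter -/

lemma runMax_le_add {t : ℝ≥0} {a c : ℝ≥0∞} (hb : Continuous fun t => B t ω) (ha : a ≠ 0)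
    (hc : c ≠ 0) :
    runMax σ μ B t a ω ≤ runMax σ μ B t c ω + |driftExt μ a - driftExt μ c| * t := by
  refine runMax_le fun s hs => ?_
  have h := le_runMax (σ := σ) (μ := μ) hb hs c
  rw [X_of_ne_zero hc] at h
  rw [X_of_ne_zero ha]
  have h1 : (driftExt μ c - driftExt μ a) * s ≤ |driftExt μ a - driftExt μ c| * s := by
    gcongr
    rw [abs_sub_comm]
    exact le_abs_self _
  have h2 : |driftExt μ a - driftExt μ c| * s ≤ |driftExt μ a - driftExt μ c| * t := by
    gcongr
  linarith

lemma continuousAt_driftExt (hμ : IsDriftFunction μ) {a : ℝ≥0} (ha : a ≠ 0) :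
    ContinuousAt (fun c : ℝ≥0 => driftExt μ c) a := by
  simp only [IsDriftFunction.driftExt_coe]
  have : ContinuousAt μ (a : ℝ) :=
    hμ.continuousOn.continuousAt (Ioi_mem_nhds (by positivity))
  exact this.comp NNReal.continuous_coe.continuousAt

lemma continuousAt_runMax (hμ : IsDriftFunction μ) (hb : Continuous fun t => B t ω) (t : ℝ≥0)
    {a : ℝ≥0} (ha : a ≠ 0) : ContinuousAt (fun c : ℝ≥0 => runMax σ μ B t c ω) a := by
  have h : Tendsto (fun c : ℝ≥0 => |driftExt μ c - driftExt μ a| * t) (𝓝 a) (𝓝 0) := by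
    have := (((continuousAt_driftExt hμ ha).tendsto.sub_const (driftExt μ a)).abs).mul_const (t : ℝ)
    simpa using this
  rw [ContinuousAt, tendsto_iff_dist_tendsto_zero]
  refine squeeze_zero' (.of_forall fun _ => dist_nonneg) ?_ h
  filter_upwards [isOpen_ne.mem_nhds ha] with c hc
  have ha' : (a : ℝ≥0∞) ≠ 0 := by exact_mod_cast ha
  have hc' : (c : ℝ≥0∞) ≠ 0 := by exact_mod_cast hc
  have h1 := runMax_le_add (σ := σ) (μ := μ) (t := t) hb ha' hc'
  have h2 := runMax_le_add (σ := σ) (μ := μ) (t := t) hb hc' ha'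
  rw [abs_sub_comm (driftExt μ a)] at h1
  rw [Real.dist_eq, abs_le]
  constructor <;> linarith

/-- For t < δ continuity of B at 0 bounds σB_t by ε; for t ≥ δ the growth B_t ≤ |K| + t is beaten by
the drift, which blows up as a tends to 0. -/
lemma eventually_forall_X_le (hμ : IsDriftFunction μ) (hb : IsGoodPath fun t => B t ω)
    (hσ : 0 < σ) {ε : ℝ} (hε : 0 < ε) :
    ∀ᶠ a : ℝ≥0 in 𝓝 0, ∀ t, X σ μ B t a ω ≤ ε := by
  obtain ⟨K, hK⟩ := hb.bddAbove 1 one_pos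
  have hcont : ∀ᶠ t : ℝ≥0 in 𝓝 0, B t ω < ε / σ := by
    have : Tendsto (fun t => B t ω) (𝓝 0) (𝓝 0) := by
      simpa [hb.zero] using hb.continuous.tendsto 0
    exact this.eventually_lt_const (by positivity)
  obtain ⟨δ, hδ, hδB⟩ : ∃ δ : ℝ≥0, 0 < δ ∧ ∀ t < δ, B t ω < ε / σ := by
    obtain ⟨δ, hδ, h⟩ := (nhds_bot_basis (α := ℝ≥0)).eventually_iff.1 hcont
    exact ⟨δ, hδ, fun t ht => h ht⟩
  -- Times t ≥ δ, this threshold is at least σt + σ|K|, the upper bound for σB_t.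
  have hlarge : ∀ᶠ x : ℝ in 𝓝[>] 0, σ + σ * |K| / δ < μ x := hμ.tendsto_zero.eventually_gt_atTop _
  obtain ⟨η, hη, hlarge⟩ := (mem_nhdsGT_iff_exists_Ioo_subset).1 hlarge
  filter_upwards [Iio_mem_nhds (show (0 : ℝ≥0) < η.toNNReal from Real.toNNReal_pos.2 hη)]
    with a ha t
  rcases eq_or_ne a 0 with rfl | ha0
  · simpa using hε.le
  have hm : σ + σ * |K| / δ < μ a :=
    hlarge ⟨by positivity, by simpa [Real.lt_toNNReal_iff_coe_lt] using ha⟩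
  have hm0 : 0 < μ a := hμ.pos _ (by positivity)
  rw [X_of_ne_zero (by exact_mod_cast ha0), IsDriftFunction.driftExt_coe]
  rcases lt_or_ge t δ with ht | ht
  · have h1 : σ * B t ω ≤ ε := by
      have := (hδB t ht).le
      rw [le_div_iff₀ hσ] at this
      linarith
    have h2 : 0 ≤ μ a * t := by positivity
    linarith
  · have h1 : B t ω - 1 * t ≤ K := hK ⟨t, rfl⟩
    have h2 : σ * B t ω ≤ σ * (|K| + t) := by
      gcongr
      linarith [le_abs_self K]
    have ht' : (δ : ℝ) ≤ t := by exact_mod_cast ht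
    have hδ' : (0 : ℝ) < δ := by exact_mod_cast hδ
    have h3 : (σ + σ * |K| / δ) * t ≤ μ a * t := by gcongr
    have h4 : σ * |K| ≤ σ * |K| / δ * t := by
      rw [div_mul_eq_mul_div, le_div_iff₀ hδ']
      gcongr
    linarith

lemma tendsto_Mstar_nhds_zero (hμ : IsDriftFunction μ) (hb : IsGoodPath fun t => B t ω)
    (hσ : 0 < σ) : Tendsto (fun a : ℝ≥0 => Mstar σ μ B a ω) (𝓝 0) (𝓝 0) := by
  rw [Metric.tendsto_nhds]
  intro ε hε
  filter_upwards [eventually_forall_X_le hμ hb hσ (half_pos hε)] with a ha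
  rw [Real.dist_eq, sub_zero, abs_of_nonneg (Mstar_nonneg hb.zero _)]
  exact (Mstar_le ha).trans_lt (half_lt_self hε)

/-- Near a ≠ 0 the maximum coincides with a running maximum at one fixed time, which is continuous
in the drift; at 0 the blow-up of μ is used. -/
lemma continuous_Mstar (hμ : IsDriftFunction μ) (hb : IsGoodPath fun t => B t ω) (hσ : 0 < σ) :
    Continuous fun a : ℝ≥0 => Mstar σ μ B a ω := by
  refine continuous_iff_continuousAt.2 fun a => ?_
  rcases eq_or_ne a 0 with rfl | ha
  · rw [ContinuousAt, ENNReal.coe_zero, Mstar_apply_zero]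
    exact tendsto_Mstar_nhds_zero hμ hb hσ
  · have hc : a + 1 ≠ 0 := by positivity
    obtain ⟨t, ht⟩ := (eventually_runMax_eq hμ hb hσ (c := ((a + 1 : ℝ≥0) : ℝ≥0∞))
      (by exact_mod_cast hc) (hμ.driftExt_coe_pos hc)).exists
    refine (continuousAt_runMax (σ := σ) hμ hb.continuous t ha).congr ?_
    filter_upwards [Iio_mem_nhds (show a < a + 1 by simp)] with c hc
    exact ht c (by exact_mod_cast (mem_Iio.1 hc).le)

/-! ### Initial conditions -/

/-- The paths of initial conditions used in the pathwise arguments. -/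
structure IsGoodInit (w : ℝ≥0 → Ω → ℝ≥0) (ω : Ω) : Prop where
  continuous : Continuous fun a => w a ω
  monotone : Monotone fun a => w a ω
  zero : w 0 ω = 0
  infty_lt_top : initAtInfty w ω < ∞
  lintegral_lt_top : (∫⁻ a in Ioc (0 : ℝ) 1, ENNReal.ofReal (w a.toNNReal ω / a ^ 2)) < ∞

lemma initAtInfty_eq_iSup (hw : Monotone fun a => w a ω) :
    initAtInfty w ω = ⨆ a, (w a ω : ℝ≥0∞) := by
  have : Monotone fun a => (w a ω : ℝ≥0∞) := fun _ _ h => ENNReal.coe_le_coe.2 (hw h)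
  exact (tendsto_atTop_iSup this).limUnder_eq

@[simp] lemma initExt_coe (a : ℝ≥0) : initExt w a ω = w a ω := by simp [initExt]

lemma initExt_zero : initExt w 0 ω = w 0 ω := initExt_coe 0

lemma initExt_nonneg (a : ℝ≥0∞) : 0 ≤ initExt w a ω := by
  unfold initExt
  split_ifs <;> positivity

namespace IsGoodInit

lemma coe_le_infty (hw : IsGoodInit w ω) (a : ℝ≥0) : (w a ω : ℝ) ≤ (initAtInfty w ω).toReal := by
  have h : (w a ω : ℝ≥0∞) ≤ initAtInfty w ω := by
    rw [initAtInfty_eq_iSup hw.monotone]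
    exact le_iSup (fun a => (w a ω : ℝ≥0∞)) a
  exact ENNReal.toReal_mono hw.infty_lt_top.ne h

lemma initExt_mono (hw : IsGoodInit w ω) : Monotone fun a => initExt w a ω := by
  intro a c hac
  rcases eq_or_ne c ∞ with rfl | hc
  · rcases eq_or_ne a ∞ with rfl | ha
    · exact le_rfl
    · simpa [initExt, ha] using hw.coe_le_infty a.toNNReal
  · have ha : a ≠ ∞ := ne_top_of_le_ne_top hc hac
    simpa [initExt, ha, hc] using hw.monotone (ENNReal.toNNReal_mono hc hac)

/-- Beyond 1 the integrand is at most w(∞)/x². -/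
lemma lintegral_Ioi_lt_top (hw : IsGoodInit w ω) :
    (∫⁻ x in Ioi (0 : ℝ), ENNReal.ofReal (w x.toNNReal ω / x ^ 2)) < ∞ := by
  rw [← Ioc_union_Ioi_eq_Ioi (zero_le_one (α := ℝ))]
  refine (lintegral_union_le _ _ _).trans_lt (ENNReal.add_lt_top.2 ⟨hw.lintegral_lt_top, ?_⟩)
  have hi : IntegrableOn (fun x : ℝ => (initAtInfty w ω).toReal * x ^ (-2 : ℝ)) (Ioi 1) :=
    (integrableOn_Ioi_rpow_of_lt (by norm_num) one_pos).const_mul _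
  refine lt_of_le_of_lt (setLIntegral_mono' measurableSet_Ioi fun x hx => ?_)
    hi.lintegral_lt_top
  have hx0 : (0 : ℝ) < x := one_pos.trans hx
  refine ENNReal.ofReal_le_ofReal ?_
  rw [Real.rpow_neg hx0.le, Real.rpow_two, ← div_eq_mul_inv]
  gcongr
  exact hw.coe_le_infty _

end IsGoodInit

/-! ### The process seen backwards in time -/

/-- The process `max (sup_{s ≤ t} X_s(a), w(a) + X_t(a))`, which has the law of `W_t(a)`. -/
noncomputable def Wrev (σ : ℝ) (μ : ℝ → ℝ) (B : ℝ≥0 → Ω → ℝ) (w : ℝ≥0 → Ω → ℝ≥0)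
    (t : ℝ≥0) (a : ℝ≥0∞) (ω : Ω) : ℝ :=
  max (runMax σ μ B t a ω) (chi σ μ B w t a ω)

lemma Wrev_nonneg (hb : Continuous fun t => B t ω) (h0 : B 0 ω = 0) (t : ℝ≥0) (a : ℝ≥0∞) :
    0 ≤ Wrev σ μ B w t a ω :=
  (runMax_nonneg hb h0 t a).trans (le_max_left _ _)

lemma Wrev_apply_zero (hw : IsGoodInit w ω) (t : ℝ≥0) : Wrev σ μ B w t 0 ω = 0 := by
  simp [Wrev, runMax_apply_zero, chi, initExt_zero, hw.zero]

lemma Wrev_mono (hμ : IsDriftFunction μ) (hb : Continuous fun t => B t ω) (h0 : B 0 ω = 0)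
    (hw : IsGoodInit w ω) (t : ℝ≥0) : Monotone fun a => Wrev σ μ B w t a ω := by
  intro a c hac
  rcases eq_or_ne a 0 with rfl | ha
  · simp only [Wrev_apply_zero hw]
    exact Wrev_nonneg hb h0 t c
  · exact max_le_max (runMax_mono hμ hb h0 t hac)
      (add_le_add (hw.initExt_mono hac) (X_mono hμ t ha hac))

lemma Wrev_le (hb : IsGoodPath fun t => B t ω) (hσ : 0 < σ) {a : ℝ≥0∞}
    (ha : a ≠ 0 → 0 < driftExt μ a) (t : ℝ≥0) :
    Wrev σ μ B w t a ω ≤ Mstar σ μ B a ω + initExt w a ω := by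
  refine max_le ?_ ?_
  · linarith [runMax_le_Mstar hb hσ ha t, initExt_nonneg (w := w) (ω := ω) a]
  · rw [chi]
    linarith [le_Mstar hb hσ ha t]

/-- For 0 < a ≤ c one has w(a) + X_t(a) ≤ w(c) + X_t(c), eventually negative: the initial condition
is forgotten while the running maxima become stationary. -/
lemma eventually_Wrev_eq (hμ : IsDriftFunction μ) (hb : IsGoodPath fun t => B t ω) (hσ : 0 < σ)
    (hw : IsGoodInit w ω) {c : ℝ≥0∞} (hc : c ≠ 0) (hd : 0 < driftExt μ c) :
    ∀ᶠ t in atTop, ∀ a ≤ c, Wrev σ μ B w t a ω = Mstar σ μ B a ω := by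
  filter_upwards [eventually_runMax_eq hμ hb hσ hc hd,
    eventually_X_lt (μ := μ) hb hσ hc hd (-initExt w c ω)] with t h1 h2 a hac
  rcases eq_or_ne a 0 with rfl | ha
  · rw [Wrev_apply_zero hw, Mstar_apply_zero]
  rw [Wrev, h1 a hac, max_eq_left]
  refine le_trans ?_ (Mstar_nonneg hb.zero a)
  have h3 := hw.initExt_mono hac
  have h4 := X_mono (σ := σ) (B := B) (ω := ω) hμ t ha hac
  dsimp only at h3
  rw [chi]
  linarith

lemma continuous_Wrev (hμ : IsDriftFunction μ) (hb : IsGoodPath fun t => B t ω) (hσ : 0 < σ)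
    (hw : IsGoodInit w ω) (t : ℝ≥0) : Continuous fun a : ℝ≥0 => Wrev σ μ B w t a ω := by
  have hwc : Continuous fun a : ℝ≥0 => initExt w a ω := by
    simp only [initExt_coe]
    exact NNReal.continuous_coe.comp hw.continuous
  refine continuous_iff_continuousAt.2 fun a => ?_
  rcases eq_or_ne a 0 with rfl | ha
  · rw [ContinuousAt, ENNReal.coe_zero, Wrev_apply_zero hw]
    have h : Tendsto (fun a : ℝ≥0 => Mstar σ μ B a ω + initExt w a ω) (𝓝 0) (𝓝 0) := by
      have := ((continuous_Mstar (σ := σ) hμ hb hσ).tendsto 0).add (hwc.tendsto 0)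
      simpa [initExt_zero, hw.zero] using this
    refine tendsto_of_tendsto_of_tendsto_of_le_of_le tendsto_const_nhds h
      (fun a => Wrev_nonneg hb.continuous hb.zero t a) fun a => ?_
    exact Wrev_le hb hσ (fun h => hμ.driftExt_coe_pos (by exact_mod_cast h)) t
  · refine (continuousAt_runMax hμ hb.continuous t ha).max (hwc.continuousAt.add ?_)
    have : ContinuousAt (fun c : ℝ≥0 => σ * B t ω - driftExt μ c * t) a :=
      continuousAt_const.sub ((continuousAt_driftExt hμ ha).mul continuousAt_const)
    refine this.congr ?_
    filter_upwards [isOpen_ne.mem_nhds ha] with c hc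
    rw [X_of_ne_zero (by exact_mod_cast hc)]

/-- Time reversal of a path on `[0, t]`. -/
noncomputable def revProc (t : ℝ≥0) (B : ℝ≥0 → Ω → ℝ) (s : ℝ≥0) (ω : Ω) : ℝ :=
  -- Keeping B after time t makes this a Brownian motion on the whole half-line; the two pieces
  -- match at t because B starts at 0.
  if s ≤ t then B t ω - B (t - s) ω else B s ω

lemma IsGoodPath.revProc (hb : IsGoodPath fun t => B t ω) (t : ℝ≥0) :
    IsGoodPath fun s => revProc t B s ω := by
  have hc : Continuous fun s => RCBM.revProc t B s ω := by
    unfold RCBM.revProc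
    refine Continuous.if_le ?_ hb.continuous continuous_id continuous_const ?_
    · exact continuous_const.sub (hb.continuous.comp (continuous_const.sub continuous_id))
    · rintro s rfl
      simp [hb.zero]
  refine ⟨hc, by simp [RCBM.revProc], fun m hm => ?_⟩
  obtain ⟨K, hK⟩ := hb.bddAbove m hm
  have hc' : Continuous fun s : ℝ≥0 => RCBM.revProc t B s ω - m * s := by fun_prop
  obtain ⟨K', hK'⟩ := (isCompact_Icc (a := (0 : ℝ≥0)) (b := t)).image hc' |>.bddAbove
  refine ⟨max K K', ?_⟩
  rintro _ ⟨s, rfl⟩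
  by_cases hs : s ≤ t
  · exact (hK' ⟨s, ⟨zero_le, hs⟩, rfl⟩).trans (le_max_right _ _)
  · refine le_trans ?_ (le_max_left _ _)
    simp only [RCBM.revProc, hs, if_false]
    exact hK ⟨s, rfl⟩

lemma X_revProc {s t : ℝ≥0} (hst : s ≤ t) (a : ℝ≥0∞) :
    X σ μ (revProc t B) (t - s) a ω = X σ μ B t a ω - X σ μ B s a ω := by
  rcases eq_or_ne a 0 with rfl | ha
  · simp
  · simp only [X_of_ne_zero ha, revProc, tsub_le_self, if_true, tsub_tsub_cancel_of_le hst,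
      NNReal.coe_sub hst]
    ring

/-- The reflected process is the backward process of the time reversed path. -/
lemma W_eq_Wrev_revProc (hb : IsGoodPath fun t => B t ω) (t : ℝ≥0) (a : ℝ≥0∞) :
    W σ μ B w t a ω = Wrev σ μ (revProc t B) w t a ω := by
  have hchi : chi σ μ (revProc t B) w t a ω = chi σ μ B w t a ω := by
    have := X_revProc (σ := σ) (μ := μ) (B := B) (ω := ω) (zero_le (a := t)) a
    rw [tsub_zero, X_zero_time hb.zero, sub_zero] at this
    rw [chi, chi, this]
  have hcont : Continuous fun s => chi σ μ B w s a ω :=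
    continuous_const.add (continuous_X hb.continuous a)
  set I := (fun s => chi σ μ B w s a ω) '' Icc 0 t with hI
  have hIb : BddBelow I := (isCompact_Icc.image hcont).bddBelow
  have hIn : I.Nonempty := ⟨_, 0, ⟨le_rfl, zero_le⟩, rfl⟩
  have hdiff (s : ℝ≥0) (hs : s ≤ t) : X σ μ (revProc t B) (t - s) a ω
      = chi σ μ B w t a ω - chi σ μ B w s a ω := by
    rw [X_revProc hs, chi, chi]; ring
  -- The substitution s ↦ t - s turns the supremum of the increments into an infimum of χ; then W_t
  -- = χ_t - min(inf χ, 0) = max(χ_t - inf χ, χ_t).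
  have hsup : runMax σ μ (revProc t B) t a ω = chi σ μ B w t a ω - sInf I := by
    refine le_antisymm (runMax_le fun s hs => ?_) ?_
    · have h := hdiff (t - s) tsub_le_self
      rw [tsub_tsub_cancel_of_le hs] at h
      rw [h]
      have := csInf_le hIb ⟨t - s, ⟨zero_le, tsub_le_self⟩, rfl⟩
      dsimp only at this
      linarith
    · have : chi σ μ B w t a ω - runMax σ μ (revProc t B) t a ω ≤ sInf I := by
        refine le_csInf hIn ?_
        rintro _ ⟨s, hs, rfl⟩
        have h1 := le_runMax (σ := σ) (μ := μ) (hb.revProc t).continuous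
          (tsub_le_self : t - s ≤ t) a
        rw [hdiff s hs.2] at h1
        dsimp only
        linarith
      linarith
  rw [W, skorokhodMap, Wrev, hsup, hchi, ← hI]
  rcases le_total (sInf I) 0 with h | h
  · rw [min_eq_left h, max_eq_left (by linarith)]
  · rw [min_eq_right h, max_eq_right (by linarith), sub_zero]

end RCBM

namespace RCBM

/-! ### The maximum of Brownian motion with negative drift -/

variable {Ω : Type*} {B : ℝ≥0 → Ω → ℝ}

/-- The exponential martingale `exp(θ B_t - θ² t / 2)`. -/
noncomputable def expMart (B : ℝ≥0 → Ω → ℝ) (θ : ℝ) (t : ℝ≥0) (ω : Ω) : ℝ :=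
  Real.exp (θ * B t ω - θ ^ 2 / 2 * t)

lemma expMart_eq (θ : ℝ) (t : ℝ≥0) :
    expMart B θ t = fun ω => Real.exp (-(θ ^ 2 / 2 * t)) * Real.exp (θ * B t ω) := by
  funext ω
  rw [expMart, ← Real.exp_add]
  congr 1
  ring

variable [MeasurableSpace Ω] {P : Measure Ω}

/-- The natural filtration of a process at the times `0, h, 2h, …`. -/
def gridFiltration (B : ℝ≥0 → Ω → ℝ) (hm : ∀ t, Measurable (B t)) (h : ℝ≥0) :
    Filtration ℕ ‹MeasurableSpace Ω› where
  seq k := MeasurableSpace.comap (fun ω (t : Iic (k * h)) => B t ω) inferInstance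
  mono' j k hjk := by
    have hle : (j : ℝ≥0) * h ≤ k * h := by gcongr
    have : (fun ω (t : Iic (j * h)) => B t ω)
        = (fun u (t : Iic (j * h)) => u ⟨t, le_trans t.2 hle⟩)
          ∘ fun ω (t : Iic (k * h)) => B t ω := rfl
    dsimp only
    rw [this, ← MeasurableSpace.comap_comp]
    exact MeasurableSpace.comap_mono (Measurable.comap_le (by fun_prop))
  le' k := Measurable.comap_le (by fun_prop)

lemma integrable_expMart (hB : IsPreBrownianReal B P) (θ : ℝ) (t : ℝ≥0) :
    Integrable (expMart B θ t) P := by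
  rw [expMart_eq]
  refine Integrable.const_mul ?_ _
  have h := integrable_exp_mul_gaussianReal (μ := 0) (v := t) θ
  rw [← (hB.hasLaw_eval t).map_eq] at h
  exact h.comp_aemeasurable (hB.aemeasurable t)

lemma integral_expMart (hB : IsPreBrownianReal B P) (θ : ℝ) (t : ℝ≥0) :
    ∫ ω, expMart B θ t ω ∂P = 1 := by
  have h : mgf (B t) P θ = Real.exp (0 * θ + t * θ ^ 2 / 2) :=
    mgf_gaussianReal (hB.hasLaw_eval t).map_eq θ
  rw [expMart_eq, integral_const_mul]
  change _ * mgf (B t) P θ = 1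
  rw [h, ← Real.exp_add, Real.exp_eq_one_iff]
  ring

/-- One grid step multiplies by the exponential of an increment that is independent of the past and
has mean one. -/
lemma martingale_expMart [IsProbabilityMeasure P] (hB : IsPreBrownianReal B P)
    (hm : ∀ t, Measurable (B t)) (θ : ℝ) (h : ℝ≥0) :
    Martingale (fun k : ℕ => expMart B θ (k * h)) (gridFiltration B hm h) P := by
  have hadp : ∀ k : ℕ, StronglyMeasurable[gridFiltration B hm h k] (expMart B θ (k * h)) := by
    intro k
    have h1 : Measurable[gridFiltration B hm h k] (B (k * h)) := by
      have : B (k * h) = (fun u : Iic ((k : ℝ≥0) * h) → ℝ => u ⟨k * h, self_mem_Iic⟩)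
          ∘ fun ω (t : Iic ((k : ℝ≥0) * h)) => B t ω := rfl
      rw [this]
      exact (measurable_pi_apply _).comp (comap_measurable _)
    exact (Real.measurable_exp.comp ((h1.const_mul θ).sub_const _)).stronglyMeasurable
  refine martingale_nat hadp (fun k => integrable_expMart hB θ _) fun k => ?_
  set t₀ : ℝ≥0 := k * h with ht₀
  set C : ℝ≥0 → Ω → ℝ := fun t ω => B (t₀ + t) ω - B t₀ ω with hC
  have hCB : IsPreBrownianReal C P := hB.shift t₀
  have hfac : expMart B θ ((k + 1 : ℕ) * h) = expMart B θ t₀ * expMart C θ h := by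
    funext ω
    simp only [expMart, Pi.mul_apply, hC, ← Real.exp_add]
    have : ((k + 1 : ℕ) : ℝ≥0) * h = t₀ + h := by rw [ht₀]; push_cast; ring
    rw [this]
    congr 1
    push_cast
    ring
  have hgi := integrable_expMart hCB θ h
  have hind : P[expMart C θ h | gridFiltration B hm h k] =ᵐ[P] fun _ => 1 := by
    have hi : Indep (MeasurableSpace.comap (C h) inferInstance) (gridFiltration B hm h k) P :=
      (IndepFun_iff_Indep _ _ _).1 ((hB.indepFun_shift t₀).comp
        (φ := fun u : ℝ≥0 → ℝ => u h) (ψ := id) (measurable_pi_apply h) measurable_id)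
    have hCm : Measurable (C h) := (hm _).sub (hm _)
    have := condExp_indep_eq hCm.comap_le ((gridFiltration B hm h).le k)
      (f := expMart C θ h) ?_ hi
    · rwa [integral_expMart hCB] at this
    · exact (Real.measurable_exp.comp
        (((comap_measurable (C h)).const_mul θ).sub_const _)).stronglyMeasurable
  rw [hfac]
  have hpull := condExp_mul_of_stronglyMeasurable_left (μ := P) (hadp k)
    (g := expMart C θ h) (hfac ▸ integrable_expMart hB θ _) hgi
  filter_upwards [hpull, hind] with ω h1 h2
  rw [h1, Pi.mul_apply, h2, mul_one]

/-- With θ = 2m the exponent θB_t - θ²t/2 equals 2m(B_t - mt). Reaching x therefore means that the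
martingale reaches exp(2mx), and Doob's maximal inequality applies. -/
lemma measure_exists_grid_le_of_measurable [IsProbabilityMeasure P] (hB : IsPreBrownianReal B P)
    (hm : ∀ t, Measurable (B t)) {m : ℝ} (hm0 : 0 < m) (x : ℝ) (h : ℝ≥0) (N : ℕ) :
    P {ω | ∃ k ≤ N, x ≤ B (k * h) ω - m * (k * h : ℝ≥0)} ≤ ENNReal.ofReal (Real.exp (-(2 * m * x))) := by
  have hmart := martingale_expMart hB hm (2 * m) h
  have hdoob := maximal_ineq hmart.submartingale (fun k ω => (Real.exp_pos _).le)
    (ε := (Real.exp (2 * m * x)).toNNReal) N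
  set A := {ω | (((Real.exp (2 * m * x)).toNNReal : ℝ≥0) : ℝ) ≤
    (Finset.range (N + 1)).sup' Finset.nonempty_range_add_one
      fun k => expMart B (2 * m) (k * h) ω} with hA
  have hsub : {ω | ∃ k ≤ N, x ≤ B (k * h) ω - m * (k * h : ℝ≥0)} ⊆ A := by
    rintro ω ⟨k, hk, hx⟩
    rw [hA, mem_ofPred_eq, Real.coe_toNNReal _ (Real.exp_pos _).le, Finset.le_sup'_iff]
    refine ⟨k, Finset.mem_range.2 (Nat.lt_succ_of_le hk), ?_⟩
    rw [expMart, Real.exp_le_exp]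
    nlinarith
  have hint : ENNReal.ofReal (∫ ω in A, expMart B (2 * m) (N * h) ω ∂P) ≤ 1 := by
    rw [← ENNReal.ofReal_one]
    refine ENNReal.ofReal_le_ofReal ?_
    rw [← integral_expMart hB (2 * m) (N * h)]
    exact setIntegral_le_integral (integrable_expMart hB _ _)
      (.of_forall fun ω => (Real.exp_pos _).le)
  have h1 : ENNReal.ofReal (Real.exp (2 * m * x)) * P A ≤ 1 := hdoob.trans hint
  calc P {ω | ∃ k ≤ N, x ≤ B (k * h) ω - m * (k * h : ℝ≥0)} ≤ P A := measure_mono hsub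
    _ = ENNReal.ofReal (Real.exp (-(2 * m * x))) * (ENNReal.ofReal (Real.exp (2 * m * x)) * P A) := by
      rw [← mul_assoc, ← ENNReal.ofReal_mul (Real.exp_pos _).le, ← Real.exp_add]
      simp
    _ ≤ ENNReal.ofReal (Real.exp (-(2 * m * x))) * 1 := by gcongr
    _ = _ := mul_one _

/-- Only countably many times are involved, so B may be replaced by a measurable version. -/
lemma measure_exists_grid_le [IsProbabilityMeasure P] (hB : IsPreBrownianReal B P)
    {m : ℝ} (hm0 : 0 < m) (x : ℝ) (h : ℝ≥0) (N : ℕ) :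
    P {ω | ∃ k ≤ N, x ≤ B (k * h) ω - m * (k * h : ℝ≥0)} ≤ ENNReal.ofReal (Real.exp (-(2 * m * x))) := by
  have hC : IsPreBrownianReal (fun t => (hB.aemeasurable t).mk (B t)) P :=
    hB.congr fun t => (hB.aemeasurable t).ae_eq_mk
  refine le_trans (measure_mono_ae ?_) (measure_exists_grid_le_of_measurable hC
    (fun t => (hB.aemeasurable t).measurable_mk) hm0 x h N)
  filter_upwards [ae_all_iff.2 fun k : ℕ => (hB.aemeasurable (k * h)).ae_eq_mk] with ω hω hx
  obtain ⟨k, hk, hx⟩ := hx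
  exact ⟨k, hk, by rwa [← hω k]⟩

/-- The maximum of Brownian motion with drift `-m` has exponential tails. -/
lemma measure_exists_lt_le [IsProbabilityMeasure P] (hB : IsBrownianReal B P)
    {m : ℝ} (hm0 : 0 < m) (x : ℝ) :
    P {ω | ∃ t : ℝ≥0, x < B t ω - m * t} ≤ ENNReal.ofReal (Real.exp (-(2 * m * x))) := by
  -- Dyadic grids of mesh 2⁻ⁿ up to time n are nested. Since the level is exceeded strictly, a
  -- continuous path also exceeds it at some grid point.
  set A : ℕ → Set Ω := fun n => {ω | ∃ k ≤ n * 2 ^ n,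
    x ≤ B (k * (2⁻¹ ^ n : ℝ≥0)) ω - m * (k * (2⁻¹ ^ n : ℝ≥0) : ℝ≥0)} with hA
  have hmono : Monotone A := by
    refine monotone_nat_of_le_succ fun n ω ⟨k, hk, hx⟩ => ⟨2 * k, ?_, ?_⟩
    · calc 2 * k ≤ 2 * (n * 2 ^ n) := by gcongr
        _ = n * 2 ^ (n + 1) := by ring
        _ ≤ (n + 1) * 2 ^ (n + 1) := by gcongr; omega
    · have : ((2 * k : ℕ) : ℝ≥0) * 2⁻¹ ^ (n + 1) = k * 2⁻¹ ^ n := by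
        push_cast
        rw [pow_succ]
        field_simp
      rwa [this]
  calc P {ω | ∃ t : ℝ≥0, x < B t ω - m * t} ≤ P (⋃ n, A n) := by
        refine measure_mono_ae ?_
        filter_upwards [hB.cont] with ω hω hx
        obtain ⟨t, ht⟩ := hx
        have hcont : Continuous fun t : ℝ≥0 => B t ω - m * t := by fun_prop
        have hlim : Tendsto (fun n : ℕ => (⌊(t : ℝ) * 2 ^ n⌋₊ : ℝ≥0) * 2⁻¹ ^ n) atTop (𝓝 t) := by
          rw [← NNReal.tendsto_coe]
          have h2 : Tendsto (fun n : ℕ => (2 : ℝ) ^ n) atTop atTop :=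
            tendsto_pow_atTop_atTop_of_one_lt (by norm_num)
          refine ((tendsto_nat_floor_mul_div_atTop t.coe_nonneg).comp h2).congr fun n => ?_
          simp [Function.comp, div_eq_mul_inv]
        have hev := (hcont.tendsto t).comp hlim |>.eventually_const_lt ht
        obtain ⟨n, hn, hnt⟩ := (hev.and (eventually_ge_atTop ⌈(t : ℝ)⌉₊)).exists
        refine mem_iUnion.2 ⟨n, ⌊(t : ℝ) * 2 ^ n⌋₊, ?_, hn.le⟩
        have htn : (t : ℝ) ≤ n := (Nat.le_ceil (t : ℝ)).trans (by exact_mod_cast hnt)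
        have : ((⌊(t : ℝ) * 2 ^ n⌋₊ : ℕ) : ℝ) ≤ ((n * 2 ^ n : ℕ) : ℝ) :=
          (Nat.floor_le (by positivity)).trans (by push_cast; gcongr)
        exact_mod_cast this
    _ = ⨆ n, P (A n) := hmono.measure_iUnion
    _ ≤ _ := iSup_le fun n => measure_exists_grid_le hB.toIsPreBrownianReal hm0 x _ _

lemma ae_bddAbove_sub_mul [IsProbabilityMeasure P] (hB : IsBrownianReal B P) {m : ℝ}
    (hm0 : 0 < m) : ∀ᵐ ω ∂P, BddAbove (range fun t : ℝ≥0 => B t ω - m * t) := by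
  rw [ae_iff]
  refine le_antisymm ?_ zero_le
  have hlim : Tendsto (fun x : ℝ => ENNReal.ofReal (Real.exp (-(2 * m * x)))) atTop (𝓝 0) := by
    rw [← ENNReal.ofReal_zero]
    refine (ENNReal.continuous_ofReal.tendsto 0).comp (Real.tendsto_exp_neg_atTop_nhds_zero.comp ?_)
    exact tendsto_id.const_mul_atTop (by positivity)
  refine ge_of_tendsto' hlim fun x => le_trans (measure_mono fun ω hω => ?_)
    (measure_exists_lt_le hB hm0 x)
  by_contra hcon
  refine hω ⟨x, ?_⟩
  rintro _ ⟨t, rfl⟩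
  by_contra hlt
  exact hcon ⟨t, not_le.1 hlt⟩

/-- Almost all Brownian paths are good. -/
lemma ae_isGoodPath [IsProbabilityMeasure P] (hB : IsBrownianReal B P) :
    ∀ᵐ ω ∂P, IsGoodPath fun t => B t ω := by
  -- The countably many drifts 1/(n + 1) suffice, since a larger drift only lowers the path.
  filter_upwards [hB.cont, hB.eval_zero_ae_eq_zero,
    ae_all_iff.2 fun n : ℕ => ae_bddAbove_sub_mul hB (Nat.one_div_pos_of_nat (α := ℝ) (n := n))]
    with ω h1 h2 h3
  refine ⟨h1, h2, fun m hm => ?_⟩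
  obtain ⟨n, hn⟩ := exists_nat_one_div_lt hm
  obtain ⟨K, hK⟩ := h3 n
  refine ⟨K, ?_⟩
  rintro _ ⟨t, rfl⟩
  have := hK ⟨t, rfl⟩
  dsimp only at this ⊢
  have : (1 / ((n : ℝ) + 1)) * t ≤ m * t := by gcongr
  linarith

lemma lintegral_exp_neg_mul {c : ℝ} (hc : 0 < c) :
    ∫⁻ x in Ioi (0 : ℝ), ENNReal.ofReal (Real.exp (-(c * x))) = ENNReal.ofReal (1 / c) := by
  have hi : IntegrableOn (fun x : ℝ => Real.exp (-(c * x))) (Ioi 0) := by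
    simpa using exp_neg_integrableOn_Ioi 0 hc
  rw [← ofReal_integral_eq_lintegral_ofReal hi (.of_forall fun x => (Real.exp_pos _).le)]
  congr 1
  have := integral_exp_mul_Ioi (neg_lt_zero.2 hc) 0
  simpa using this

end RCBM

namespace RCBM

/-! ### Suprema over countable dense sets -/

lemma ciSup_denseSeq {u : ℝ≥0 → ℝ} (hu : Continuous u) (hb : BddAbove (range u)) :
    ⨆ t, u t = ⨆ n, u (TopologicalSpace.denseSeq ℝ≥0 n) := by
  have hb' : BddAbove (range fun n => u (TopologicalSpace.denseSeq ℝ≥0 n)) :=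
    hb.mono (range_comp_subset_range _ u)
  refine le_antisymm (ciSup_le fun t => ?_) (ciSup_le fun n => le_ciSup hb _)
  exact isClosed_property (TopologicalSpace.denseRange_denseSeq ℝ≥0)
    (isClosed_le hu continuous_const) (fun n => le_ciSup hb' n) t

variable {Ω : Type*} {σ : ℝ} {μ : ℝ → ℝ} {B : ℝ≥0 → Ω → ℝ} {w : ℝ≥0 → Ω → ℝ≥0} {ω : Ω}

lemma runMax_eq_iSup (hb : Continuous fun t => B t ω) (t : ℝ≥0) (a : ℝ≥0∞) :
    runMax σ μ B t a ω = ⨆ n, X σ μ B (min (TopologicalSpace.denseSeq ℝ≥0 n) t) a ω := by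
  -- Stopping at t turns [0, t] into the whole half-line, to which the fixed dense sequence applies.
  have e : (fun s => X σ μ B s a ω) '' Icc 0 t = range fun s => X σ μ B (min s t) a ω := by
    ext y
    constructor
    · rintro ⟨s, hs, rfl⟩
      exact ⟨s, by simp [min_eq_left hs.2]⟩
    · rintro ⟨s, rfl⟩
      exact ⟨min s t, ⟨zero_le, min_le_right _ _⟩, rfl⟩
  rw [runMax, e]
  refine ciSup_denseSeq (u := fun s => X σ μ B (min s t) a ω)
    ((continuous_X hb a).comp (continuous_id.min continuous_const)) ?_
  rw [← e]
  exact (isCompact_Icc.image (continuous_X hb a)).bddAbove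

/-! ### The backward process at countably many points -/

/-- Countably many values of the initial condition. -/
noncomputable def initValues (v : ℝ≥0 → ℝ≥0) (n : ℕ) : ℝ≥0 × ℝ≥0 :=
  -- The values at integers serve to recover w(∞) as a countable supremum.
  (v (TopologicalSpace.denseSeq ℝ≥0 n), v n)

/-- Countably many times in `[0, t]`, with `t` among them. -/
noncomputable def gridTime (t : ℝ≥0) : Option ℕ → ℝ≥0
  | none => t
  | some n => min (TopologicalSpace.denseSeq ℝ≥0 n) t

/-- The backward process as a function of countably many values of the driving path. -/
noncomputable def backwardFun (σ : ℝ) (μ : ℝ → ℝ) (t : ℝ≥0) (a : ℝ≥0∞) (x : ℝ)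
    (v : Option ℕ → ℝ) : ℝ :=
  max (⨆ n : ℕ, if a = 0 then 0 else σ * v (some n) - driftExt μ a * gridTime t (some n))
    (x + if a = 0 then 0 else σ * v none - driftExt μ a * t)

lemma measurable_backwardFun (t : ℝ≥0) (a : ℝ≥0∞) :
    Measurable fun p : ℝ × (Option ℕ → ℝ) => backwardFun σ μ t a p.1 p.2 := by
  unfold backwardFun
  refine (Measurable.iSup fun n => ?_).max (measurable_fst.add ?_)
  · split_ifs <;> fun_prop
  · split_ifs <;> fun_prop

lemma Wrev_eq_backwardFun (hb : Continuous fun t => B t ω) (t : ℝ≥0) (a : ℝ≥0∞) :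
    Wrev σ μ B w t a ω = backwardFun σ μ t a (initExt w a ω) fun i => B (gridTime t i) ω := by
  rw [Wrev, runMax_eq_iSup hb]
  rfl

lemma initAtInfty_eq_iSup_nat (hw : Monotone fun a => w a ω) :
    initAtInfty w ω = ⨆ n : ℕ, (w n ω : ℝ≥0∞) := by
  rw [initAtInfty_eq_iSup hw]
  refine le_antisymm (iSup_le fun a => ?_) (iSup_le fun n => le_iSup (fun a => (w a ω : ℝ≥0∞)) n)
  refine le_trans ?_ (le_iSup (fun n : ℕ => (w n ω : ℝ≥0∞)) ⌈a⌉₊)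
  exact ENNReal.coe_le_coe.2 (hw (Nat.le_ceil a))

/-- Countably many values of the backward process as a function of countably many values of the
initial condition and of the driving path. -/
noncomputable def backwardValues (σ : ℝ) (μ : ℝ → ℝ) (t : ℝ≥0)
    (p : (ℕ → ℝ≥0 × ℝ≥0) × (Option ℕ → ℝ)) : (ℕ → ℝ) × ℝ :=
  (fun n => backwardFun σ μ t (TopologicalSpace.denseSeq ℝ≥0 n) (p.1 n).1 p.2,
    backwardFun σ μ t ∞ (⨆ n, ((p.1 n).2 : ℝ≥0∞)).toReal p.2)

lemma measurable_backwardValues (t : ℝ≥0) : Measurable (backwardValues σ μ t) := by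
  refine (measurable_pi_iff.2 fun n => ?_).prodMk ?_
  · exact (measurable_backwardFun t _).comp (by fun_prop : Measurable
      fun p : (ℕ → ℝ≥0 × ℝ≥0) × (Option ℕ → ℝ) => (((p.1 n).1 : ℝ), p.2))
  · refine (measurable_backwardFun t _).comp (Measurable.prodMk ?_ measurable_snd)
    refine (Measurable.iSup fun n => ?_).ennreal_toReal
    fun_prop

lemma denseValues_Wrev (hb : Continuous fun t => B t ω) (hw : Monotone fun a => w a ω)
    (t : ℝ≥0) : denseValues (fun a => Wrev σ μ B w t a ω)
      = backwardValues σ μ t (initValues fun a => w a ω, fun i => B (gridTime t i) ω) := by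
  simp only [denseValues, backwardValues, Wrev_eq_backwardFun hb, initExt_coe, initValues]
  rw [initExt, if_pos rfl, initAtInfty_eq_iSup_nat hw]

/-! ### Measurability and moments of the maximum -/

variable [MeasurableSpace Ω] {P : Measure Ω}

lemma aemeasurable_X (hB : IsPreBrownianReal B P) (t : ℝ≥0) (a : ℝ≥0∞) :
    AEMeasurable (fun ω => X σ μ B t a ω) P := by
  have := hB.aemeasurable t
  unfold X
  split_ifs <;> fun_prop

lemma aemeasurable_Mstar [IsProbabilityMeasure P] (hB : IsBrownianReal B P) (hσ : 0 < σ)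
    {a : ℝ≥0∞} (ha : a ≠ 0 → 0 < driftExt μ a) :
    AEMeasurable (fun ω => Mstar σ μ B a ω) P := by
  refine (AEMeasurable.iSup fun n => aemeasurable_X (σ := σ) (μ := μ) hB.toIsPreBrownianReal
    (TopologicalSpace.denseSeq ℝ≥0 n) a).congr ?_
  filter_upwards [ae_isGoodPath hB] with ω hω
  exact (ciSup_denseSeq (continuous_X hω.continuous a) (bddAbove_X hω hσ ha)).symm

/-- The expected maximum of Brownian motion with negative drift. -/
lemma lintegral_Mstar_le [IsProbabilityMeasure P] (hB : IsBrownianReal B P) (hσ : 0 < σ)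
    {a : ℝ≥0∞} (ha : a ≠ 0) (hd : 0 < driftExt μ a) :
    ∫⁻ ω, ENNReal.ofReal (Mstar σ μ B a ω) ∂P ≤ ENNReal.ofReal (σ ^ 2 / (2 * driftExt μ a)) := by
  set m := driftExt μ a with hm
  rw [lintegral_eq_lintegral_meas_lt P ?_ (aemeasurable_Mstar hB hσ fun _ => hd)]
  · have hc : 0 < 2 * m / σ ^ 2 := by positivity
    calc ∫⁻ x in Ioi (0 : ℝ), P {ω | x < Mstar σ μ B a ω}
        ≤ ∫⁻ x in Ioi (0 : ℝ), ENNReal.ofReal (Real.exp (-(2 * m / σ ^ 2 * x))) := by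
          refine setLIntegral_mono' measurableSet_Ioi fun x _ => ?_
          -- Dividing by σ leaves drift m/σ and level x/σ, so the tail decays at rate 2m/σ², with
          -- integral σ²/(2m).
          have h := measure_exists_lt_le hB (div_pos hd hσ) (x / σ)
          have e : 2 * (m / σ) * (x / σ) = 2 * m / σ ^ 2 * x := by field_simp
          rw [e] at h
          refine le_trans (measure_mono fun ω hω => ?_) h
          obtain ⟨t, ht⟩ := exists_lt_of_lt_ciSup (show x < ⨆ t, X σ μ B t a ω from hω)
          refine ⟨t, ?_⟩
          rw [X_of_ne_zero ha, ← hm] at ht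
          rw [div_lt_iff₀ hσ]
          have : (B t ω - m / σ * t) * σ = σ * B t ω - m * t := by field_simp
          linarith
      _ = ENNReal.ofReal (1 / (2 * m / σ ^ 2)) := lintegral_exp_neg_mul hc
      _ = ENNReal.ofReal (σ ^ 2 / (2 * m)) := by rw [one_div_div]
  · filter_upwards [hB.eval_zero_ae_eq_zero] with ω hω using Mstar_nonneg hω a

/-! ### Time reversal of Brownian motion -/

/-- Each value is a linear function of at most two values of B. -/
lemma isGaussianProcess_revProc (hB : IsPreBrownianReal B P) (t : ℝ≥0) :
    IsGaussianProcess (revProc t B) P := by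
  refine hB.isGaussianProcess.of_isGaussianProcess fun s => ?_
  by_cases hs : s ≤ t
  · exact ⟨{t, t - s},
      { toFun x := x ⟨t, by simp⟩ - x ⟨t - s, by simp⟩
        map_add' x y := by simp; abel
        map_smul' c x := by simp; ring }, by simp [revProc, hs]⟩
  · exact ⟨{s},
      { toFun x := x ⟨s, by simp⟩
        map_add' x y := by simp
        map_smul' c x := by simp }, by simp [revProc, hs]⟩

/-- The time reversal of a Brownian motion is a Brownian motion. -/
lemma isPreBrownianReal_revProc (hB : IsPreBrownianReal B P) (t : ℝ≥0) :
    IsPreBrownianReal (revProc t B) P := by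
  have hP := hB.isGaussianProcess.isProbabilityMeasure
  have hL (s : ℝ≥0) : MemLp (B s) 2 P := (hB.isGaussianProcess.hasGaussianLaw_eval s).memLp_two
  have hle {s : ℝ≥0} (hs : s ≤ t) : revProc t B s = B t - B (t - s) := by
    funext ω; simp [revProc, hs]
  have hgt {s : ℝ≥0} (hs : ¬s ≤ t) : revProc t B s = B s := by
    funext ω; simp [revProc, hs]
  refine (isGaussianProcess_revProc hB t).isPreBrownianReal_of_covariance (fun s => ?_)
    (fun s u hsu => ?_)
  · by_cases hs : s ≤ t
    · rw [hle hs]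
      simp only [Pi.sub_apply]
      rw [integral_sub (hB.integrable_eval _) (hB.integrable_eval _), hB.integral_eval,
        hB.integral_eval, sub_zero]
    · rw [hgt hs, hB.integral_eval]
  -- For s ≤ u ≤ t the covariance is t - (t - u) - (t - s) + (t - u) = s; for s ≤ t < u it is t - (t
  -- - s) = s.
  · by_cases hu : u ≤ t
    · have hs := hsu.trans hu
      rw [hle hs, hle hu, covariance_sub_left (hL _) (hL _) ((hL _).sub (hL _)),
        covariance_sub_right (hL _) (hL _) (hL _), covariance_sub_right (hL _) (hL _) (hL _)]
      simp only [hB.covariance_eval]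
      rw [min_self, min_eq_right (tsub_le_self : t - u ≤ t),
        min_eq_left (tsub_le_self : t - s ≤ t), min_eq_right (tsub_le_tsub_left hsu t),
        NNReal.coe_sub hs]
      ring
    · rw [hgt hu]
      have htu := (not_le.1 hu).le
      by_cases hs : s ≤ t
      · rw [hle hs, covariance_sub_left (hL _) (hL _) (hL _)]
        simp only [hB.covariance_eval]
        rw [min_eq_left htu, min_eq_left (tsub_le_self.trans htu), NNReal.coe_sub hs]
        ring
      · rw [hgt hs, hB.covariance_eval, min_eq_left hsu]

lemma identDistrib_comp_of_isPreBrownianReal {C : ℝ≥0 → Ω → ℝ} {ι : Type*} [Countable ι]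
    (hB : IsPreBrownianReal B P) (hC : IsPreBrownianReal C P) (τ : ι → ℝ≥0) :
    IdentDistrib (fun ω i => B (τ i) ω) (fun ω i => C (τ i) ω) P P := by
  classical
  have hP := hB.isGaussianProcess.isProbabilityMeasure
  refine (identDistrib_iff_forall_finset_identDistrib
    (X := fun i ω => B (τ i) ω) (Y := fun i ω => C (τ i) ω)
    (aemeasurable_pi_lambda _ fun i => hB.aemeasurable _)
    (aemeasurable_pi_lambda _ fun i => hC.aemeasurable _)).2 fun J => ?_
  -- Times may repeat under τ, so the finite-dimensional laws are compared on the image and pulled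
  -- back.
  have h : IdentDistrib (fun ω => (J.image τ).restrict (B · ω))
      (fun ω => (J.image τ).restrict (C · ω)) P P :=
    ⟨(hB.hasLaw _).aemeasurable, (hC.hasLaw _).aemeasurable, by
      rw [(hB.hasLaw _).map_eq, (hC.hasLaw _).map_eq]⟩
  exact h.comp (u := fun x (j : J) => x ⟨τ j, Finset.mem_image_of_mem τ j.2⟩) (by fun_prop)

/-! ### The law of the backward process -/

lemma measurable_initValues : Measurable initValues := by
  unfold initValues
  fun_prop

/-- The reflected process at time `t` and the backward process at time `t` have the same law. -/
lemma identDistrib_W_Wrev [IsProbabilityMeasure P] (hB : IsBrownianReal B P)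
    (hw : IsFiniteInitialCondition P B w) (t : ℝ≥0) :
    IdentDistrib (fun ω => denseValues fun a => W σ μ B w t a ω)
      (fun ω => denseValues fun a => Wrev σ μ B w t a ω) P P := by
  have hCB := isPreBrownianReal_revProc hB.toIsPreBrownianReal t
  have hv := identDistrib_comp_of_isPreBrownianReal hCB hB.toIsPreBrownianReal (gridTime t)
  have hu : IdentDistrib (fun ω => initValues fun a => w a ω)
      (fun ω => initValues fun a => w a ω) P P := IdentDistrib.refl
    (aemeasurable_pi_lambda _ fun n => (hw.aemeasurable _).prodMk (hw.aemeasurable _))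
  -- The reversed values are functions of B alone, so independence from w survives the reversal and
  -- the joint laws agree.
  have hi1 : IndepFun (fun ω => initValues fun a => w a ω)
      (fun ω i => revProc t B (gridTime t i) ω) P := by
    refine hw.indep.comp (ψ := fun (b : ℝ≥0 → ℝ) i => if gridTime t i ≤ t then b t - b (t - gridTime t i)
      else b (gridTime t i)) measurable_initValues (measurable_pi_iff.2 fun i => ?_)
    split_ifs <;> fun_prop
  have hi2 : IndepFun (fun ω => initValues fun a => w a ω) (fun ω i => B (gridTime t i) ω) P :=
    hw.indep.comp (ψ := fun (b : ℝ≥0 → ℝ) i => b (gridTime t i)) measurable_initValues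
      (measurable_pi_iff.2 fun i => measurable_pi_apply _)
  have h := (hu.prodMk hv hi1 hi2).comp (measurable_backwardValues (σ := σ) (μ := μ) t)
  have e1 : backwardValues σ μ t ∘ (fun ω => (initValues fun a => w a ω,
      fun i => revProc t B (gridTime t i) ω)) =ᵐ[P]
      fun ω => denseValues fun a => W σ μ B w t a ω := by
    filter_upwards [ae_isGoodPath hB, hw.monotone] with ω hω hmono
    simp only [W_eq_Wrev_revProc hω]
    exact (denseValues_Wrev (hω.revProc t).continuous hmono t).symm
  have e2 : backwardValues σ μ t ∘ (fun ω => (initValues fun a => w a ω,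
      fun i => B (gridTime t i) ω)) =ᵐ[P]
      fun ω => denseValues fun a => Wrev σ μ B w t a ω := by
    filter_upwards [hB.cont, hw.monotone] with ω hω hmono
    exact (denseValues_Wrev hω hmono t).symm
  refine ⟨h.aemeasurable_fst.congr e1, h.aemeasurable_snd.congr e2, ?_⟩
  rw [← Measure.map_congr e1, ← Measure.map_congr e2]
  exact h.map_eq

end RCBM

namespace RCBM

/-! ### Almost sure properties -/

variable {Ω : Type*} {σ : ℝ} {μ : ℝ → ℝ} {B : ℝ≥0 → Ω → ℝ} {w : ℝ≥0 → Ω → ℝ≥0} {ω : Ω}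

lemma isAdmissible_Mstar (hμ : IsDriftFunction μ) (hb : IsGoodPath fun t => B t ω) (hσ : 0 < σ)
    (hM : (∫⁻ x in Ioi (0 : ℝ), ENNReal.ofReal (Mstar σ μ B (ENNReal.ofReal x) ω / x ^ 2)) < ∞) :
    IsAdmissible fun a => Mstar σ μ B a ω where
  continuous := continuous_Mstar hμ hb hσ
  monotone a c hac := by
    rcases eq_or_ne a 0 with rfl | ha
    · simpa using Mstar_nonneg hb.zero _
    · have hc : c ≠ 0 := ((pos_iff_ne_zero.2 ha).trans_le hac).ne'
      exact Mstar_le fun t => (X_mono hμ t (by exact_mod_cast ha) (by exact_mod_cast hac)).trans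
        (le_Mstar hb hσ (fun _ => hμ.driftExt_coe_pos hc) t)
  zero := Mstar_apply_zero
  lintegral_lt_top := hM

/-- The integrand which dominates the densities of the backward process. -/
noncomputable def dominant (σ : ℝ) (μ : ℝ → ℝ) (B : ℝ≥0 → Ω → ℝ) (w : ℝ≥0 → Ω → ℝ≥0) (ω : Ω)
    (x : ℝ) : ℝ≥0∞ :=
  ENNReal.ofReal (Mstar σ μ B (ENNReal.ofReal x) ω / x ^ 2)
    + ENNReal.ofReal (w x.toNNReal ω / x ^ 2)

lemma lintegral_dominant_lt_top (hμ : IsDriftFunction μ) (hb : IsGoodPath fun t => B t ω)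
    (hσ : 0 < σ) (hw : IsGoodInit w ω)
    (hM : (∫⁻ x in Ioi (0 : ℝ), ENNReal.ofReal (Mstar σ μ B (ENNReal.ofReal x) ω / x ^ 2)) < ∞) :
    (∫⁻ x in Ioi (0 : ℝ), dominant σ μ B w ω x) < ∞ := by
  unfold dominant
  rw [lintegral_add_left
    (isAdmissible_Mstar hμ hb hσ hM).measurable_density.ennreal_ofReal]
  exact ENNReal.add_lt_top.2 ⟨hM, hw.lintegral_Ioi_lt_top⟩

lemma ofReal_Wrev_le_dominant (hμ : IsDriftFunction μ) (hb : IsGoodPath fun t => B t ω)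
    (hσ : 0 < σ) (t : ℝ≥0) (x : ℝ) :
    ENNReal.ofReal (Wrev σ μ B w t (ENNReal.ofReal x) ω / x ^ 2) ≤ dominant σ μ B w ω x := by
  rw [dominant, ← ENNReal.ofReal_add (by have := Mstar_nonneg (σ := σ) (μ := μ) hb.zero; bound)
    (by positivity), ← add_div]
  refine ENNReal.ofReal_le_ofReal ?_
  gcongr
  have := Wrev_le (w := w) hb hσ (a := ENNReal.ofReal x)
    (fun h => hμ.driftExt_coe_pos (a := x.toNNReal) (ENNReal.coe_ne_zero.1 h)) t
  rwa [ENNReal.ofReal, initExt_coe] at this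

lemma isAdmissible_Wrev (hμ : IsDriftFunction μ) (hb : IsGoodPath fun t => B t ω) (hσ : 0 < σ)
    (hw : IsGoodInit w ω)
    (hM : (∫⁻ x in Ioi (0 : ℝ), ENNReal.ofReal (Mstar σ μ B (ENNReal.ofReal x) ω / x ^ 2)) < ∞)
    (t : ℝ≥0) : IsAdmissible fun a => Wrev σ μ B w t a ω where
  continuous := continuous_Wrev hμ hb hσ hw t
  monotone _ _ hac := Wrev_mono hμ hb.continuous hb.zero hw t (ENNReal.coe_le_coe.2 hac)
  zero := Wrev_apply_zero hw t
  lintegral_lt_top := (lintegral_mono fun x => ofReal_Wrev_le_dominant hμ hb hσ t x).trans_lt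
    (lintegral_dominant_lt_top hμ hb hσ hw hM)

lemma tendsto_toPath {F : ℝ≥0 → ℝ≥0∞ → ℝ} {f : ℝ≥0∞ → ℝ}
    (hF : ∀ t, Continuous fun a : ℝ≥0 => F t a) (hf : Continuous fun a : ℝ≥0 => f a)
    (hloc : ∀ A : ℝ≥0, ∀ᶠ t in atTop, ∀ a : ℝ≥0, a ≤ A → F t a = f a) :
    Tendsto (fun t => toPath (F t)) atTop (𝓝 (toPath f)) := by
  rw [ContinuousMap.tendsto_iff_forall_isCompact_tendstoUniformlyOn]
  intro K hK
  obtain ⟨A, hA⟩ := hK.bddAbove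
  rw [Metric.tendstoUniformlyOn_iff]
  intro ε hε
  filter_upwards [hloc A] with t ht a ha
  rw [toPath_apply (hF t), toPath_apply hf, ht a (hA ha), dist_self]
  exact hε

lemma eventually_Wrev_coe_eq (hμ : IsDriftFunction μ) (hb : IsGoodPath fun t => B t ω)
    (hσ : 0 < σ) (hw : IsGoodInit w ω) (A : ℝ≥0) :
    ∀ᶠ t in atTop, ∀ a : ℝ≥0, a ≤ A → Wrev σ μ B w t a ω = Mstar σ μ B a ω := by
  have hc : A + 1 ≠ 0 := by positivity
  filter_upwards [eventually_Wrev_eq hμ hb hσ hw (c := ((A + 1 : ℝ≥0) : ℝ≥0∞))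
    (by exact_mod_cast hc) (hμ.driftExt_coe_pos hc)] with t ht a ha
  exact ht a (by exact_mod_cast ha.trans (le_add_of_nonneg_right zero_le_one))

lemma tendsto_toPath_Wrev (hμ : IsDriftFunction μ) (hb : IsGoodPath fun t => B t ω)
    (hσ : 0 < σ) (hw : IsGoodInit w ω) :
    Tendsto (fun t => toPath fun a => Wrev σ μ B w t a ω) atTop
      (𝓝 (toPath fun a => Mstar σ μ B a ω)) :=
  tendsto_toPath (continuous_Wrev hμ hb hσ hw) (continuous_Mstar hμ hb hσ)
    (eventually_Wrev_coe_eq hμ hb hσ hw)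

/-- A positive limiting drift allows c = ∞ in `eventually_Wrev_eq`. -/
lemma tendsto_Wrev_infty (hμ : IsDriftFunction μ) (hb : IsGoodPath fun t => B t ω)
    (hσ : 0 < σ) (hw : IsGoodInit w ω) (hd : 0 < driftAtInfty μ) :
    Tendsto (fun t => (Wrev σ μ B w t ∞ ω).toNNReal) atTop (𝓝 (Mstar σ μ B ∞ ω).toNNReal) := by
  refine tendsto_const_nhds.congr' ?_
  filter_upwards [eventually_Wrev_eq hμ hb hσ hw (c := ∞) (by simp)
    (by simpa [driftExt] using hd)] with t ht
  rw [ht ∞ le_rfl]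

lemma tendsto_associatedMeasure_Wrev (hμ : IsDriftFunction μ) (hb : IsGoodPath fun t => B t ω)
    (hσ : 0 < σ) (hw : IsGoodInit w ω)
    (hM : (∫⁻ x in Ioi (0 : ℝ), ENNReal.ofReal (Mstar σ μ B (ENNReal.ofReal x) ω / x ^ 2)) < ∞) :
    Tendsto (fun t => associatedMeasure fun a => Wrev σ μ B w t a ω) atTop
      (𝓝 (associatedMeasure fun a => Mstar σ μ B a ω)) :=
  tendsto_associatedMeasure (isAdmissible_Wrev hμ hb hσ hw hM) (isAdmissible_Mstar hμ hb hσ hM)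
    (eventually_Wrev_coe_eq hμ hb hσ hw) (fun t x _ => ofReal_Wrev_le_dominant hμ hb hσ t x)
    (lintegral_dominant_lt_top hμ hb hσ hw hM).ne

variable [MeasurableSpace Ω] {P : Measure Ω}

lemma ae_isGoodInit [IsProbabilityMeasure P] (hw : IsFiniteInitialCondition P B w) :
    ∀ᵐ ω ∂P, IsGoodInit w ω := by
  have h1 : ∀ᵐ ω ∂P, initAtInfty w ω < ∞ := by
    refine ae_lt_top' ?_ hw.lintegral_infty_lt_top.ne
    refine (AEMeasurable.iSup fun n : ℕ => (hw.aemeasurable n).coe_nnreal_ennreal).congr ?_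
    filter_upwards [hw.monotone] with ω hω using (initAtInfty_eq_iSup_nat hω).symm
  have hc : ∀ᵐ ω ∂P, Continuous fun a : ℝ≥0 => initExt w a ω := by
    filter_upwards [hw.continuous] with ω hω
    simp only [initExt_coe]
    exact NNReal.continuous_coe.comp hω
  -- Regarding w as a random continuous path makes its integral a measurable function of ω.
  have hpath : AEMeasurable (fun ω => toPath fun a => initExt w a ω) P := by
    refine aemeasurable_toPath (fun a => ?_) hc
    simp only [initExt_coe]
    exact (hw.aemeasurable a).coe_nnreal_real
  have h2 : ∀ᵐ ω ∂P,
      (∫⁻ a in Ioc (0 : ℝ) 1, ENNReal.ofReal (w a.toNNReal ω / a ^ 2)) < ∞ := by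
    refine ae_lt_top' ?_ hw.lintegral_lt_top.ne
    refine ((measurable_lintegral_path (Ioc 0 1)).comp_aemeasurable hpath).congr ?_
    filter_upwards [hc] with ω hω
    simp only [Function.comp, toPath_apply (f := fun a => initExt w a ω) hω, initExt_coe]
  filter_upwards [hw.continuous, hw.monotone, hw.zero, h1, h2] with ω a b c d e
  exact ⟨a, b, c, d, e⟩

lemma aemeasurable_toPath_Mstar [IsProbabilityMeasure P] (hB : IsBrownianReal B P)
    (hμ : IsDriftFunction μ) (hσ : 0 < σ) :
    AEMeasurable (fun ω => toPath fun a => Mstar σ μ B a ω) P :=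
  aemeasurable_toPath
    (fun a => aemeasurable_Mstar hB hσ fun h => hμ.driftExt_coe_pos (by exact_mod_cast h))
    ((ae_isGoodPath hB).mono fun _ hω => continuous_Mstar hμ hω hσ)

/-- The density of the measure associated with the maximum process is almost surely
integrable. -/
lemma ae_lintegral_Mstar_lt_top [IsProbabilityMeasure P] (hB : IsBrownianReal B P)
    (hμ : IsDriftFunction μ) (hσ : 0 < σ)
    (hint : (∫⁻ a in Ioi (0 : ℝ), ENNReal.ofReal (1 / (a ^ 2 * μ a))) < ∞) :
    ∀ᵐ ω ∂P,
      (∫⁻ x in Ioi (0 : ℝ), ENNReal.ofReal (Mstar σ μ B (ENNReal.ofReal x) ω / x ^ 2)) < ∞ := by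
  have hY := aemeasurable_toPath_Mstar hB hμ hσ
  -- Tonelli needs joint measurability in ω and x, which holds for a measurable version of the
  -- random path evaluated at x.
  set Y := hY.mk with hYdef
  have hYm : Measurable Y := hY.measurable_mk
  have hYeq : ∀ᵐ ω ∂P, ∀ a : ℝ≥0, Y ω a = Mstar σ μ B a ω := by
    filter_upwards [hY.ae_eq_mk, ae_isGoodPath hB] with ω h1 h2 a
    rw [hYdef, ← h1, toPath_apply (continuous_Mstar hμ h2 hσ)]
  have hjoint : Measurable fun p : Ω × ℝ => ENNReal.ofReal (Y p.1 p.2.toNNReal / p.2 ^ 2) :=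
    ((measurable_eval_path.comp ((hYm.comp measurable_fst).prodMk measurable_snd)).div
      (measurable_snd.pow_const 2)).ennreal_ofReal
  have hfin : ∀ᵐ ω ∂P,
      (∫⁻ x in Ioi (0 : ℝ), ENNReal.ofReal (Y ω x.toNNReal / x ^ 2)) < ∞ := by
    refine ae_lt_top hjoint.lintegral_prod_right' (ne_of_lt ?_)
    rw [lintegral_lintegral_swap hjoint.aemeasurable]
    calc ∫⁻ x in Ioi (0 : ℝ), ∫⁻ ω, ENNReal.ofReal (Y ω x.toNNReal / x ^ 2) ∂P
        ≤ ∫⁻ x in Ioi (0 : ℝ), ENNReal.ofReal (σ ^ 2 / 2) * ENNReal.ofReal (1 / (x ^ 2 * μ x)) := by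
          refine setLIntegral_mono' measurableSet_Ioi fun x hx => ?_
          have hx0 : (0 : ℝ) < x := hx
          have hxn : x.toNNReal ≠ 0 := (Real.toNNReal_pos.2 hx0).ne'
          have hd : driftExt μ x.toNNReal = μ x := by
            rw [IsDriftFunction.driftExt_coe, Real.coe_toNNReal _ hx0.le]
          have hb := lintegral_Mstar_le (σ := σ) (μ := μ) hB hσ (a := x.toNNReal)
            (by exact_mod_cast hxn) (hμ.driftExt_coe_pos hxn)
          rw [hd] at hb
          have e : ∫⁻ ω, ENNReal.ofReal (Y ω x.toNNReal / x ^ 2) ∂P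
              = ∫⁻ ω, ENNReal.ofReal (1 / x ^ 2) *
                ENNReal.ofReal (Mstar σ μ B x.toNNReal ω) ∂P := by
            refine lintegral_congr_ae ?_
            filter_upwards [hYeq] with ω hω
            rw [hω, ← ENNReal.ofReal_mul (by positivity)]
            congr 1
            ring
          rw [e, lintegral_const_mul' _ _ ENNReal.ofReal_ne_top]
          refine (mul_le_mul_right hb _).trans_eq ?_
          have := hμ.pos x hx0
          rw [← ENNReal.ofReal_mul (by positivity), ← ENNReal.ofReal_mul (by positivity)]
          congr 1
          field_simp
      _ = ENNReal.ofReal (σ ^ 2 / 2) * ∫⁻ x in Ioi (0 : ℝ), ENNReal.ofReal (1 / (x ^ 2 * μ x)) :=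
          lintegral_const_mul' _ _ ENNReal.ofReal_ne_top
      _ < ∞ := ENNReal.mul_lt_top ENNReal.ofReal_lt_top hint
  filter_upwards [hYeq, hfin] with ω h1 h2
  simpa only [ENNReal.ofReal, h1] using h2

lemma isBrownianReal_revProc [IsProbabilityMeasure P] (hB : IsBrownianReal B P) (t : ℝ≥0) :
    IsBrownianReal (revProc t B) P where
  toIsPreBrownianReal := isPreBrownianReal_revProc hB.toIsPreBrownianReal t
  cont := (ae_isGoodPath hB).mono fun _ hω => (hω.revProc t).continuous

/-- At fixed t, W_t is the backward process of the reversed path, and the integrability of the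
maximum applies to that path because it is a Brownian motion. The null set depends on t. -/
lemma ae_isAdmissible_W [IsProbabilityMeasure P] (hB : IsBrownianReal B P)
    (hμ : IsDriftFunction μ) (hσ : 0 < σ) (hw : IsFiniteInitialCondition P B w)
    (hint : (∫⁻ a in Ioi (0 : ℝ), ENNReal.ofReal (1 / (a ^ 2 * μ a))) < ∞) (t : ℝ≥0) :
    ∀ᵐ ω ∂P, IsAdmissible fun a => W σ μ B w t a ω := by
  filter_upwards [ae_isGoodPath hB, ae_isGoodInit hw,
    ae_lintegral_Mstar_lt_top (isBrownianReal_revProc hB t) hμ hσ hint] with ω h1 h2 h3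
  simp only [W_eq_Wrev_revProc h1]
  exact isAdmissible_Wrev hμ (h1.revProc t) hσ h2 h3 t

lemma ae_isAdmissible_Mstar [IsProbabilityMeasure P] (hB : IsBrownianReal B P)
    (hμ : IsDriftFunction μ) (hσ : 0 < σ)
    (hint : (∫⁻ a in Ioi (0 : ℝ), ENNReal.ofReal (1 / (a ^ 2 * μ a))) < ∞) :
    ∀ᵐ ω ∂P, IsAdmissible fun a => Mstar σ μ B a ω := by
  filter_upwards [ae_isGoodPath hB, ae_lintegral_Mstar_lt_top hB hμ hσ hint] with ω h1 h2
  exact isAdmissible_Mstar hμ h1 hσ h2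

/-! ### Convergence in distribution -/

/-- Functionals of the reflected process converge in distribution if the same functionals of the
backward process converge almost surely. -/
lemma convergesInDistribution_of_backward [IsProbabilityMeasure P] (hB : IsBrownianReal B P)
    (hμ : IsDriftFunction μ) (hσ : 0 < σ) (hw : IsFiniteInitialCondition P B w) {S : Type*}
    [TopologicalSpace S] [MeasurableSpace S] [OpensMeasurableSpace S] {Φ : C(ℝ≥0, ℝ) × ℝ → S}
    (hΦ : Measurable Φ) {Y : ℝ≥0 → Ω → S} {Z : Ω → S}
    (hY : ∀ t, ∀ᵐ ω ∂P, Φ (toPath fun a => W σ μ B w t a ω, W σ μ B w t ∞ ω) = Y t ω)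
    (hZ : AEMeasurable Z P)
    (hlim : ∀ᵐ ω ∂P, Tendsto
      (fun t => Φ (toPath fun a => Wrev σ μ B w t a ω, Wrev σ μ B w t ∞ ω)) atTop (𝓝 (Z ω))) :
    ConvergesInDistribution P Y Z := by
  refine convergesInDistribution_of_identDistrib (fun t => ?_) hZ hlim
  have h := (identDistrib_toPath (identDistrib_W_Wrev (σ := σ) (μ := μ) hB hw t) ?_ ?_).comp hΦ
  · exact ⟨h.aemeasurable_fst.congr (hY t), h.aemeasurable_snd, by
      rw [← Measure.map_congr (hY t)]; exact h.map_eq⟩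
  · filter_upwards [ae_isGoodPath hB, ae_isGoodInit hw] with ω h1 h2
    simp only [W_eq_Wrev_revProc h1]
    exact continuous_Wrev hμ (h1.revProc t) hσ h2 t
  · filter_upwards [ae_isGoodPath hB, ae_isGoodInit hw] with ω h1 h2
    exact continuous_Wrev hμ h1 hσ h2 t

end RCBM

/-! ### The limit theorem -/

theorem theorem1 {Ω : Type*} [MeasurableSpace Ω] (P : Measure Ω) [IsProbabilityMeasure P]
    (B : ℝ≥0 → Ω → ℝ) (hB : IsBrownianReal B P)
    (σ : ℝ) (hσ : 0 < σ) (μ : ℝ → ℝ) (hμ : RCBM.IsDriftFunction μ)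
    (w : ℝ≥0 → Ω → ℝ≥0) (hw : RCBM.IsFiniteInitialCondition P B w) :
    -- the processes are well defined: almost surely nonnegative, finite and continuous in `a`
    (∀ᵐ ω ∂P,
      (∀ t a, 0 ≤ RCBM.W σ μ B w t a ω) ∧
      (∀ t, Continuous fun a : ℝ≥0 => RCBM.W σ μ B w t a ω) ∧
      (∀ a, 0 ≤ RCBM.Mstar σ μ B a ω) ∧
      (∀ a : ℝ≥0, BddAbove (range fun t => RCBM.X σ μ B t a ω)) ∧
      (Continuous fun a : ℝ≥0 => RCBM.Mstar σ μ B a ω)) ∧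
    -- (i)
    RCBM.ConvergesInDistribution P
      (fun t ω => RCBM.toPath fun a => RCBM.W σ μ B w t a ω)
      (fun ω => RCBM.toPath fun a => RCBM.Mstar σ μ B a ω) ∧
    (0 < RCBM.driftAtInfty μ →
      (∀ᵐ ω ∂P, BddAbove (range fun t => RCBM.X σ μ B t ∞ ω)) ∧
      RCBM.ConvergesInDistribution P
        (fun t ω => (RCBM.toPath fun a => RCBM.W σ μ B w t a ω,
          (RCBM.W σ μ B w t ∞ ω).toNNReal))
        (fun ω => (RCBM.toPath fun a => RCBM.Mstar σ μ B a ω,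
          (RCBM.Mstar σ μ B ∞ ω).toNNReal))) ∧
    -- (ii)
    ((∫⁻ a in Ioi (0 : ℝ), ENNReal.ofReal (1 / (a ^ 2 * μ a))) < ∞ →
      (∀ t, ∀ᵐ ω ∂P, ∃! ζ : FiniteMeasure ℝ≥0,
        RCBM.IsAssociatedMeasure (fun a => RCBM.W σ μ B w t a ω) ζ) ∧
      (∀ᵐ ω ∂P, ∃! ζ : FiniteMeasure ℝ≥0,
        RCBM.IsAssociatedMeasure (fun a => RCBM.Mstar σ μ B a ω) ζ) ∧
      RCBM.ConvergesInDistribution P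
        (fun t ω => (RCBM.toPath fun a => RCBM.W σ μ B w t a ω,
          RCBM.associatedMeasure fun a => RCBM.W σ μ B w t a ω))
        (fun ω => (RCBM.toPath fun a => RCBM.Mstar σ μ B a ω,
          RCBM.associatedMeasure fun a => RCBM.Mstar σ μ B a ω)) ∧
      (0 < RCBM.driftAtInfty μ →
        RCBM.ConvergesInDistribution P
          (fun t ω => (RCBM.toPath fun a => RCBM.W σ μ B w t a ω,
            (RCBM.W σ μ B w t ∞ ω).toNNReal,
            RCBM.associatedMeasure fun a => RCBM.W σ μ B w t a ω))
          (fun ω => (RCBM.toPath fun a => RCBM.Mstar σ μ B a ω,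
            (RCBM.Mstar σ μ B ∞ ω).toNNReal,
            RCBM.associatedMeasure fun a => RCBM.Mstar σ μ B a ω)))) := by
  have hgood := RCBM.ae_isGoodPath hB
  have hinit := RCBM.ae_isGoodInit hw
  have hpath := RCBM.aemeasurable_toPath_Mstar hB hμ hσ
  have hdrift (hd : 0 < RCBM.driftAtInfty μ) : (∞ : ℝ≥0∞) ≠ 0 → 0 < RCBM.driftExt μ ∞ :=
    fun _ => by simpa [RCBM.driftExt] using hd
  refine ⟨?_, ?_, fun hd => ⟨?_, ?_⟩, fun hint => ?_⟩
  · filter_upwards [hgood, hinit] with ω h1 h2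
    simp only [RCBM.W_eq_Wrev_revProc h1]
    exact ⟨fun t a => RCBM.Wrev_nonneg (h1.revProc t).continuous (h1.revProc t).zero t a,
      fun t => RCBM.continuous_Wrev hμ (h1.revProc t) hσ h2 t,
      fun a => RCBM.Mstar_nonneg h1.zero a,
      fun a => RCBM.bddAbove_X h1 hσ fun ha => hμ.driftExt_coe_pos (by exact_mod_cast ha),
      RCBM.continuous_Mstar hμ h1 hσ⟩
  · refine RCBM.convergesInDistribution_of_backward hB hμ hσ hw measurable_fst
      (fun t => .of_forall fun ω => rfl) hpath ?_
    filter_upwards [hgood, hinit] with ω h1 h2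
    exact RCBM.tendsto_toPath_Wrev hμ h1 hσ h2
  · exact hgood.mono fun ω h1 => RCBM.bddAbove_X h1 hσ (hdrift hd)
  -- Passing to ℝ≥0 loses nothing almost surely, as W_t(∞) and M_*(∞) are nonnegative.
  · refine RCBM.convergesInDistribution_of_backward hB hμ hσ hw
      (Φ := fun p => (p.1, p.2.toNNReal)) (by fun_prop) (fun t => .of_forall fun ω => rfl)
      (hpath.prodMk (RCBM.aemeasurable_Mstar hB hσ (hdrift hd)).real_toNNReal) ?_
    filter_upwards [hgood, hinit] with ω h1 h2
    exact (RCBM.tendsto_toPath_Wrev hμ h1 hσ h2).prodMk_nhds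
      (RCBM.tendsto_Wrev_infty hμ h1 hσ h2 hd)
  have hadW := RCBM.ae_isAdmissible_W hB hμ hσ hw hint
  have hadM := RCBM.ae_isAdmissible_Mstar hB hμ hσ hint
  have hfin := RCBM.ae_lintegral_Mstar_lt_top hB hμ hσ hint
  have hmeas : AEMeasurable (fun ω => RCBM.associatedMeasure fun a => RCBM.Mstar σ μ B a ω) P :=
    (RCBM.measurable_pathMeasure.comp_aemeasurable hpath).congr
      (hadM.mono fun ω h => h.pathMeasure_toPath)
  refine ⟨fun t => (hadW t).mono fun ω h => h.existsUnique, hadM.mono fun ω h => h.existsUnique,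
    ?_, fun hd => ?_⟩
  -- The measure is written as the measurable functional `pathMeasure` of the path, so equality in
  -- law of paths carries over to the pair.
  · refine RCBM.convergesInDistribution_of_backward hB hμ hσ hw
      (Φ := fun p => (p.1, RCBM.pathMeasure p.1))
      (measurable_fst.prodMk (RCBM.measurable_pathMeasure.comp measurable_fst))
      (fun t => (hadW t).mono fun ω h => by simp only [h.pathMeasure_toPath])
      (hpath.prodMk hmeas) ?_
    filter_upwards [hgood, hinit, hfin] with ω h1 h2 h3
    simp only [(RCBM.isAdmissible_Wrev hμ h1 hσ h2 h3 _).pathMeasure_toPath]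
    exact (RCBM.tendsto_toPath_Wrev hμ h1 hσ h2).prodMk_nhds
      (RCBM.tendsto_associatedMeasure_Wrev hμ h1 hσ h2 h3)
  · refine RCBM.convergesInDistribution_of_backward hB hμ hσ hw
      (Φ := fun p => (p.1, p.2.toNNReal, RCBM.pathMeasure p.1))
      (measurable_fst.prodMk (measurable_snd.real_toNNReal.prodMk
        (RCBM.measurable_pathMeasure.comp measurable_fst)))
      (fun t => (hadW t).mono fun ω h => by simp only [h.pathMeasure_toPath])
      (hpath.prodMk ((RCBM.aemeasurable_Mstar hB hσ (hdrift hd)).real_toNNReal.prodMk hmeas)) ?_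
    filter_upwards [hgood, hinit, hfin] with ω h1 h2 h3
    simp only [(RCBM.isAdmissible_Wrev hμ h1 hσ h2 h3 _).pathMeasure_toPath]
    exact (RCBM.tendsto_toPath_Wrev hμ h1 hσ h2).prodMk_nhds
      ((RCBM.tendsto_Wrev_infty hμ h1 hσ h2 hd).prodMk_nhds
        (RCBM.tendsto_associatedMeasure_Wrev hμ h1 hσ h2 h3))
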